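/- **Proposition (Superposition coding with subspace alignment).** Let $N\ge 1$, $F,G\in\mathbb{C}^{N\times N}$, $\sigma\ge 0$, $P\ge 0$, and consider the channel $y=(F+sG)x+z$ with $s\sim\mathcal{CN}(0,\sigma^2)$ and $z\sim\mathcal{CN}(0,I_N)$, where $x,s,z$ are independent. Logarithms are natural, and $I$ denotes mutual information in nats. The capacity is $$C(P)=\sup_{P_x:\ \mathbb{E}\|x\|^2\le P} I(x;y).$$ Let $\mathcal V(F,G)$ be the set of $V\in\mathbb{C}^{N\times(N-1)}$ with $V^HV=I_{N-1}$ and $\operatorname{rank}[FV\ \ GV]\le N-1$. For $V\in\mathcal V(F,G)$ let $\mathcal S$ be the span of the columns of $FV$ and $GV$, and let $U$ and $U_\perp$ be any matrices whose columns form orthonormal bases of $\mathcal S$ and of $\mathcal S^\perp$, respectively. Consider all choices of $V\in\mathcal V(F,G)$, a unit vector $v_p\in\mathbb{C}^N$, a positive semidefinite $Q_d\in\mathbb{C}^{(N-1)\times(N-1)}$ with $\operatorname{tr}Q_d\le P$, and a probability law $P_{w_p}$ on $\mathbb{C}$ with $\mathbb{E}|w_p|^2\le P-\operatorname{tr}Q_d$.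 Let $w_p\sim P_{w_p}$, $w_d\sim\mathcal{CN}(0,Q_d)$, $s$ and $z$ be independent, and put $x_p=v_pw_p$, $x=x_p+Vw_d$, $y=(F+sG)x+z$. Define the rate of the coarse layer $$R_p=I\bigl(w_p;\ (U_\perp^HFv_p+s\,U_\perp^HGv_p)\,w_p+U_\perp^Hz\bigr).$$ Put $g_\perp=U_\perp^HGx_p$, $\sigma_e^2=\sigma^2/(1+\sigma^2\|g_\perp\|^2)$ (that is, $(\|g_\perp\|^2+\sigma^{-2})^{-1}$ if $\sigma>0$), let $$\hat s=\sigma_e^2\,g_\perp^HU_\perp^H(y-Fx_p)$$ be the MMSE estimate of $s$ from $x_p$ and the projection of $y-Fx_p$ onto $\mathcal S^\perp$, put $$R=I+\sigma_e^2\,U^HG\,(x_px_p^H+VQ_dV^H)\,G^HU,$$ and define the rate of the refined layer, decoded with the LMMSE filter conditional on $(\hat s,x_p)$, $$R_d=\mathbb{E}\Bigl[\log\det\bigl(I+Q_dV^H(F+\hat sG)^HU\,R^{-1}U^H(F+\hat sG)V\bigr)\Bigr],$$ with the expectation over the joint law of $(x_p,\hat s)$. Then such choices exist, for each of them the random variable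 in $R_d$ is integrable and $R_d\ge 0$, and $$C(P)\ \ge\ \sup_{P_{w_p},\,V,\,v_p,\,Q_d}\ (R_p+R_d).$$ -/

import Mathlib

open scoped NNReal ENNReal Matrix MatrixOrder ComplexOrder
open MeasureTheory ProbabilityTheory

noncomputable section

namespace DopplerChannel

/-! ### Mutual information and complex Gaussian laws -/

/-- Mutual information `I(X; Y)` in nats of two random variables on `(Ω, μ)`: the Kullback-Leibler
divergence of the joint law from the product of the marginal laws. -/
def mutualInfo {Ω α β : Type*} [MeasurableSpace Ω] [MeasurableSpace α] [MeasurableSpace β]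
    (μ : Measure Ω) (X : Ω → α) (Y : Ω → β) : ℝ≥0∞ :=
  InformationTheory.klDiv (μ.map fun ω => (X ω, Y ω)) ((μ.map X).prod (μ.map Y))

/-- The circularly symmetric scalar law `CN(0, v)`: independent real and imaginary parts, each
`N(0, v / 2)`. -/
def scalarCN (v : ℝ≥0) : Measure ℂ :=
  ((gaussianReal 0 (v / 2)).prod (gaussianReal 0 (v / 2))).map fun p => Complex.mk p.1 p.2

/-- The law `CN(0, I_n)` on `ℂⁿ`. -/
def stdCN (n : ℕ) : Measure (Fin n → ℂ) :=
  Measure.pi fun _ => scalarCN 1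

/-- The law `CN(0, Q)` on `ℂⁿ` for positive semidefinite `Q`: the image of `CN(0, I_n)` under the
positive semidefinite square root of `Q`. -/
def vectorCN {n : ℕ} (Q : Matrix (Fin n) (Fin n) ℂ) : Measure (Fin n → ℂ) :=
  (stdCN n).map fun u => CFC.sqrt Q *ᵥ u

/-- The squared Euclidean norm `‖x‖²` of a vector of `ℂⁿ`. -/
def sqNorm {n : ℕ} (x : Fin n → ℂ) : ℝ := ∑ i, ‖x i‖ ^ 2

/-! ### The channel and its capacity -/

variable {N : ℕ}

/-- The channel output `y = (F + s G) x + z`. -/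
def output (F G : Matrix (Fin N) (Fin N) ℂ) (s : ℂ) (x z : Fin N → ℂ) : Fin N → ℂ :=
  (F + s • G) *ᵥ x + z

/-- The information `I(x; y)` sent over the channel by an input `x` with law `p`, where
`s ∼ CN(0, σ²)` and `z ∼ CN(0, I_N)`, and `x`, `s`, `z` are independent. -/
def channelInfo (F G : Matrix (Fin N) (Fin N) ℂ) (σ : ℝ≥0) (p : Measure (Fin N → ℂ)) : ℝ≥0∞ :=
  mutualInfo (p.prod ((scalarCN (σ ^ 2)).prod (stdCN N)))
    (fun ω => ω.1) (fun ω => output F G ω.2.1 ω.1 ω.2.2)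

/-- The capacity `C(P)`: the largest `I(x; y)` over all input laws with `E ‖x‖² ≤ P`. -/
def capacity (F G : Matrix (Fin N) (Fin N) ℂ) (σ : ℝ≥0) (P : ℝ) : ℝ≥0∞ :=
  ⨆ (p : Measure (Fin N → ℂ)) (_ : IsProbabilityMeasure p)
    (_ : ∫⁻ x, ENNReal.ofReal (sqNorm x) ∂p ≤ ENNReal.ofReal P), channelInfo F G σ p

/-! ### Subspace alignment -/

/-- The set `𝒱(F, G)` of the semi-unitary `N × (N-1)` matrices `V` with
`rank [F V  G V] ≤ N - 1`. -/
def alignedPrecoders (F G : Matrix (Fin N) (Fin N) ℂ) : Set (Matrix (Fin N) (Fin (N - 1)) ℂ) :=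
  {V | Vᴴ * V = 1 ∧ (Matrix.fromCols (F * V) (G * V)).rank ≤ N - 1}

/-- The subspace of `ℂᴺ` spanned by the columns of `A`. -/
def colSpace {ι : Type} [Fintype ι] [DecidableEq ι] (A : Matrix (Fin N) ι ℂ) :
    Submodule ℂ (EuclideanSpace ℂ (Fin N)) :=
  LinearMap.range (Matrix.toEuclideanLin A)

/-- The receiver subspace `𝒮(F, G, V)`, spanned by the columns of `F V` and `G V`. -/
def alignSubspace (F G : Matrix (Fin N) (Fin N) ℂ) (V : Matrix (Fin N) (Fin (N - 1)) ℂ) :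
    Submodule ℂ (EuclideanSpace ℂ (Fin N)) :=
  colSpace (Matrix.fromCols (F * V) (G * V))

/-- The columns of `U` are an orthonormal basis of the subspace `S`. -/
def IsOrthonormalBasisOf {k : ℕ} (U : Matrix (Fin N) (Fin k) ℂ)
    (S : Submodule ℂ (EuclideanSpace ℂ (Fin N))) : Prop :=
  Uᴴ * U = 1 ∧ colSpace U = S

/-- The data of a superposition scheme with subspace alignment: the law `P_{w_p}` and the direction
`v_p` of the coarse layer, the precoder `V` and the covariance `Q_d` of the refined layer, and the
matrices `U` and `U_⊥` that the receiver projects with. -/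
structure Scheme (N : ℕ) where
  coarseLaw : Measure ℂ
  V : Matrix (Fin N) (Fin (N - 1)) ℂ
  vp : Fin N → ℂ
  Qd : Matrix (Fin (N - 1)) (Fin (N - 1)) ℂ
  dimS : ℕ
  dimPerp : ℕ
  U : Matrix (Fin N) (Fin dimS) ℂ
  Uperp : Matrix (Fin N) (Fin dimPerp) ℂ

namespace Scheme

/-- The power constraints, the alignment constraint, and the constraint that `U` and `U_⊥` are
orthonormal bases of `𝒮(F, G, V)` and of its orthogonal complement. -/
structure Feasible (c : Scheme N) (F G : Matrix (Fin N) (Fin N) ℂ) (P : ℝ) : Prop where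
  isProbabilityMeasure : IsProbabilityMeasure c.coarseLaw
  aligned : c.V ∈ alignedPrecoders F G
  unit : sqNorm c.vp = 1
  posSemidef : c.Qd.PosSemidef
  refinedPower : c.Qd.trace.re ≤ P
  coarsePower : ∫⁻ w, ENNReal.ofReal (‖w‖ ^ 2) ∂c.coarseLaw ≤ ENNReal.ofReal (P - c.Qd.trace.re)
  basis : IsOrthonormalBasisOf c.U (alignSubspace F G c.V)
  basisPerp : IsOrthonormalBasisOf c.Uperp (alignSubspace F G c.V)ᗮ

variable (c : Scheme N) (F G : Matrix (Fin N) (Fin N) ℂ) (σ : ℝ≥0)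

/-- The coarse-layer signal `x_p = v_p w_p`. -/
def xp (w : ℂ) : Fin N → ℂ := w • c.vp

/-- The rate of the coarse layer,
`R_p = I(w_p; (U_⊥ᴴ F v_p + s U_⊥ᴴ G v_p) w_p + U_⊥ᴴ z)`, with `w_p`, `s ∼ CN(0, σ²)` and
`z ∼ CN(0, I_N)` independent. -/
def coarseRate : ℝ≥0∞ :=
  mutualInfo (c.coarseLaw.prod ((scalarCN (σ ^ 2)).prod (stdCN N)))
    (fun ω => ω.1)
    (fun ω => ω.1 • (c.Uperpᴴ *ᵥ (F *ᵥ c.vp) + ω.2.1 • (c.Uperpᴴ *ᵥ (G *ᵥ c.vp)))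
      + c.Uperpᴴ *ᵥ ω.2.2)

/-- The vector `g_⊥ = U_⊥ᴴ G x_p`. -/
def gPerp (w : ℂ) : Fin c.dimPerp → ℂ := c.Uperpᴴ *ᵥ (G *ᵥ c.xp w)

/-- The error variance `(‖g_⊥‖² + σ⁻²)⁻¹` of the MMSE estimator of `s`, written so that it is also
right (equal to `0`) for `σ = 0`. -/
def errVar (w : ℂ) : ℝ := (σ : ℝ) ^ 2 / (1 + (σ : ℝ) ^ 2 * sqNorm (c.gPerp G w))

theorem errVar_eq (hσ : σ ≠ 0) (w : ℂ) :
    c.errVar G σ w = (sqNorm (c.gPerp G w) + ((σ : ℝ) ^ 2)⁻¹)⁻¹ := by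
  have h : (σ : ℝ) ≠ 0 := by exact_mod_cast hσ
  have h2 : (σ : ℝ) ^ 2 ≠ 0 := pow_ne_zero 2 h
  have h3 : sqNorm (c.gPerp G w) + ((σ : ℝ) ^ 2)⁻¹
      = (1 + (σ : ℝ) ^ 2 * sqNorm (c.gPerp G w)) / (σ : ℝ) ^ 2 := by
    field_simp
    ring
  rw [h3, inv_div]
  rfl

/-- The joint law of `(w_p, w_d, s, z)`: independent, with `w_p ∼ P_{w_p}`, `w_d ∼ CN(0, Q_d)`,
`s ∼ CN(0, σ²)` and `z ∼ CN(0, I_N)`. -/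
def law : Measure (ℂ × (Fin (N - 1) → ℂ) × ℂ × (Fin N → ℂ)) :=
  c.coarseLaw.prod ((vectorCN c.Qd).prod ((scalarCN (σ ^ 2)).prod (stdCN N)))

/-- The transmitted signal `x = x_p + V w_d`. -/
def input (w : ℂ) (wd : Fin (N - 1) → ℂ) : Fin N → ℂ := c.xp w + c.V *ᵥ wd

/-- The MMSE estimate `ŝ = (‖g_⊥‖² + σ⁻²)⁻¹ g_⊥ᴴ U_⊥ᴴ (y - F x_p)` of `s`, as a function of the
decoded coarse symbol `w_p` and the channel output `y`. -/
def sHat (w : ℂ) (y : Fin N → ℂ) : ℂ :=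
  (c.errVar G σ w : ℂ) * (star (c.gPerp G w) ⬝ᵥ (c.Uperpᴴ *ᵥ (y - F *ᵥ c.xp w)))

/-- The matrix `R = I + Uᴴ σ_e² G (x_p x_pᴴ + V Q_d Vᴴ) Gᴴ U`. -/
def noiseCov (w : ℂ) : Matrix (Fin c.dimS) (Fin c.dimS) ℂ :=
  1 + c.Uᴴ * ((c.errVar G σ w : ℂ) •
    (G * (Matrix.vecMulVec (c.xp w) (star (c.xp w)) + c.V * c.Qd * c.Vᴴ) * Gᴴ)) * c.U

/-- `log det (I + Q_d Vᴴ (F + t G)ᴴ U R⁻¹ Uᴴ (F + t G) V)`, where `t` is the value of `ŝ`. The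
determinant is a real number, at least `1`. -/
def logDet (w t : ℂ) : ℝ :=
  Real.log (1 + c.Qd * (c.Vᴴ * (F + t • G)ᴴ * c.U * (c.noiseCov G σ w)⁻¹ * c.Uᴴ
    * (F + t • G) * c.V)).det.re

/-- The random variable whose expectation is the rate of the refined layer. -/
def refinedLogDet (ω : ℂ × (Fin (N - 1) → ℂ) × ℂ × (Fin N → ℂ)) : ℝ :=
  c.logDet F G σ ω.1
    (c.sHat F G σ ω.1 (output F G ω.2.2.1 (c.input ω.1 ω.2.1) ω.2.2.2))

/-- The rate `R_d` of the refined layer. -/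
def refinedRate : ℝ := ∫ ω, c.refinedLogDet F G σ ω ∂(c.law σ)

/-- `R_SA = R_p + R_d`. -/
def rate : ℝ≥0∞ := c.coarseRate F G σ + ENNReal.ofReal (c.refinedRate F G σ)

end Scheme

end DopplerChannel

end

/-!
Write `w_d = Q_d^{1/2} u` with `u ∼ CN(0, I)`, and let the channel be driven by the law of `x =
v_p w_p + V w_d`, which meets the power constraint (`lintegral_sqNorm_inputLaw`). By data
processing `I(x; y) ≥ I((w_p, u); y)` (`mutualInfo_latent_le`). Alignment means that `y_p = U_⊥ᴴ
y` does not depend on `u`. So the chain rule for the divergence, applied at the pair `(w_p, y_p)`,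
splits off the coarse rate `I(w_p; y_p)`, and the rest is the divergence of the law of `(w_p, u,
y)` from a law under which `u ∼ CN(0, I)` is independent of `(w_p, y)`. By Donsker–Varadhan the
rest is at least `E log q` for every metric `q(u | w_p, y)` with `E_u q(u | w_p, y) ≤ 1`
(`mutualInfo_superposition_le`).

For `q` take the density, relative to `CN(0, I)`, of the Gaussian law whose mean is the LMMSE
estimate of `u` from `(ŝ, w_p)` and `r = Uᴴ (y - (F + ŝ G) x_p)`, and whose covariance is `M⁻¹`,
where `M = I + Hᴴ R⁻¹ H` and `H = Uᴴ (F + ŝ G) V Q_d^{1/2}`. It is normalized by a Gaussian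
integral (`lintegral_exp_stdCN`), and `log q = log det M + ‖u‖² - (u - û)ᴴ M (u - û)`, with `û`
the LMMSE estimate. Given `w_p`, the estimate `ŝ`, the error `s - ŝ` and `Uᴴ z` are independent
Gaussians (`map_sHat_error_noise`). So given `(w_p, ŝ)` the residual is `r = H u + n`, with a
noise `n` that is uncorrelated with `u` and has covariance `R`; hence the error `u - û` has
covariance `M⁻¹`, and the last two terms of `log q` both have mean `N - 1`
(`lintegral_lmmse_error`). What remains is `E log det M = R_d`.

Integrability of the log-determinant follows from `0 ≤ log det M ≤ tr (Hᴴ H)`, because `ŝ` has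
finite second moment. An aligned precoder exists because some `u ≠ 0` has `Fᴴ u` and `Gᴴ u` on a
common line, which is a generalized eigenvalue problem (`alignedPrecoders_nonempty`).
-/

noncomputable section

namespace DopplerChannel

/-! ### Lower bounds on Kullback-Leibler divergence and mutual information -/

/-- The Donsker–Varadhan lower bound: if `∫ exp f dν ≤ 1`, then `∫ f dμ` is at most the divergence
of `μ` from `ν`. The gap is the divergence of `μ` from the tilted measure `ν.tilted f`, up to the
nonpositive term `log ∫ exp f dν`. -/
theorem ofReal_integral_le_klDiv {α : Type*} [MeasurableSpace α] (μ ν : Measure α)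
    [IsProbabilityMeasure μ] [IsProbabilityMeasure ν] {f : α → ℝ} (hf : Measurable f)
    (hfμ : Integrable f μ) (hfν : ∫⁻ x, ENNReal.ofReal (Real.exp (f x)) ∂ν ≤ 1) :
    ENNReal.ofReal (∫ x, f x ∂μ) ≤ InformationTheory.klDiv μ ν := by
  by_cases h : μ ≪ ν ∧ Integrable (llr μ ν) μ
  swap
  · have : InformationTheory.klDiv μ ν = ∞ := by
      rw [InformationTheory.klDiv_eq_top_iff]; tauto
    simp [this]
  obtain ⟨hμν, hint⟩ := h
  have hexp : Integrable (fun x => Real.exp (f x)) ν := by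
    refine ⟨(hf.exp).aestronglyMeasurable, ?_⟩
    rw [hasFiniteIntegral_iff_ofReal (ae_of_all _ fun x => (Real.exp_pos _).le)]
    exact hfν.trans_lt ENNReal.one_lt_top
  have hle : ∫ x, Real.exp (f x) ∂ν ≤ 1 := by
    rw [integral_eq_lintegral_of_nonneg_ae (ae_of_all _ fun x => (Real.exp_pos _).le)
      hexp.1]
    exact ENNReal.toReal_le_of_le_ofReal zero_le_one (by simpa using hfν)
  have hlog : Real.log (∫ x, Real.exp (f x) ∂ν) ≤ 0 :=
    Real.log_nonpos (integral_nonneg fun x => (Real.exp_pos _).le) hle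
  have := isProbabilityMeasure_tilted hexp
  have hac : μ ≪ ν.tilted f := hμν.trans (absolutelyContinuous_tilted hexp)
  have h1 := InformationTheory.integral_llr_add_sub_measure_univ_nonneg hac
    (integrable_llr_tilted_right hμν hfμ hint hexp)
  rw [integral_llr_tilted_right hμν hfμ hexp hint] at h1
  rw [InformationTheory.klDiv_of_ac_of_integrable hμν hint]
  apply ENNReal.ofReal_le_ofReal
  simp only [probReal_univ] at h1 ⊢
  linarith

/-- Tonelli for the two outer variables of a fourfold integral. -/
theorem lintegral_swap_four {α β γ δ : Type*} [MeasurableSpace α]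
    [MeasurableSpace β] [MeasurableSpace γ] [MeasurableSpace δ] (μ : Measure α) (ν : Measure β)
    (ρ : Measure γ) (τ : Measure δ) [SFinite μ] [SFinite ν] [SFinite ρ] [SFinite τ]
    {f : α → β → γ → δ → ℝ≥0∞}
    (hf : Measurable fun q : α × β × γ × δ => f q.1 q.2.1 q.2.2.1 q.2.2.2) :
    ∫⁻ a, ∫⁻ b, ∫⁻ c, ∫⁻ d, f a b c d ∂τ ∂ρ ∂ν ∂μ =
      ∫⁻ b, ∫⁻ a, ∫⁻ c, ∫⁻ d, f a b c d ∂τ ∂ρ ∂μ ∂ν := by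
  apply lintegral_lintegral_swap
  apply Measurable.aemeasurable
  have h1 : Measurable fun q : (α × β) × γ => ∫⁻ d, f q.1.1 q.1.2 q.2 d ∂τ :=
    Measurable.lintegral_prod_right' (f := fun q : ((α × β) × γ) × δ =>
      f q.1.1.1 q.1.1.2 q.1.2 q.2) (hf.comp
        (by fun_prop : Measurable fun q : ((α × β) × γ) × δ => (q.1.1.1, q.1.1.2, q.1.2, q.2)))
  exact h1.lintegral_prod_right'

section Superposition

variable {𝓦 𝓓 𝓝 𝓧 𝓨 𝓣 : Type*} [MeasurableSpace 𝓦] [MeasurableSpace 𝓓] [MeasurableSpace 𝓝]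
  [MeasurableSpace 𝓧] [MeasurableSpace 𝓨] [MeasurableSpace 𝓣]

/-- Data processing along the Markov chain `a → x = enc a → y`: the latent variable `a` carries no
more information about `y` than the channel input does. The kernel that resamples `a` given `x` and
keeps `y` turns the joint law of `(x, y)` into that of `(a, y)`, and likewise for the products of
marginals. -/
theorem mutualInfo_latent_le [StandardBorelSpace 𝓦] [Nonempty 𝓦]
    (pA : Measure 𝓦) (pN : Measure 𝓝) [IsProbabilityMeasure pA] [IsProbabilityMeasure pN]
    {enc : 𝓦 → 𝓧} {chan : 𝓧 → 𝓝 → 𝓨} (henc : Measurable enc)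
    (hchan : Measurable (Function.uncurry chan)) :
    mutualInfo (pA.prod pN) (fun ω => ω.1) (fun ω => chan (enc ω.1) ω.2) ≤
      mutualInfo ((pA.map enc).prod pN) (fun ω => ω.1) (fun ω => chan ω.1 ω.2) := by
  have hpX : IsProbabilityMeasure (pA.map enc) := Measure.isProbabilityMeasure_map henc.aemeasurable
  have hc : Measurable fun ω : 𝓧 × 𝓝 => chan ω.1 ω.2 := hchan
  have hce : Measurable fun ω : 𝓦 × 𝓝 => chan (enc ω.1) ω.2 :=
    hchan.comp ((henc.comp measurable_fst).prodMk measurable_snd)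
  -- `κ₀` is the conditional law of the latent variable given the channel input
  let κ₀ : Kernel 𝓧 𝓦 := condDistrib id enc pA
  let κ : Kernel (𝓧 × 𝓨) (𝓦 × 𝓨) :=
    (κ₀.prodMkRight 𝓨) ×ₖ Kernel.deterministic Prod.snd measurable_snd
  have hκ₀ : ∀ f : 𝓧 → 𝓦 → ℝ≥0∞, Measurable (Function.uncurry f) →
      ∫⁻ x, ∫⁻ a, f x a ∂(κ₀ x) ∂(pA.map enc) = ∫⁻ a, f (enc a) a ∂pA := by
    intro f hf
    have h := compProd_map_condDistrib (mβ := inferInstance) (μ := pA) (X := enc) (Y := id)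
      aemeasurable_id
    have h2 := Measure.lintegral_compProd (μ := pA.map enc) (κ := κ₀) hf
    simp only [Function.uncurry] at h2
    rw [← h2]
    change ∫⁻ p, f p.1 p.2 ∂(pA.map enc ⊗ₘ condDistrib id enc pA) = _
    rw [h]
    exact lintegral_map hf (henc.prodMk measurable_id)
  have hκ : ∀ (m : Measure (𝓧 × 𝓨)) [SFinite m] (f : 𝓦 × 𝓨 → ℝ≥0∞), Measurable f →
      ∫⁻ p, f p ∂(κ ∘ₘ m) = ∫⁻ q, ∫⁻ a, f (a, q.2) ∂(κ₀ q.1) ∂m := by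
    intro m _ f hf
    rw [Measure.lintegral_bind (Kernel.aemeasurable _) hf.aemeasurable]
    refine lintegral_congr fun q => ?_
    simp only [κ]
    rw [Kernel.lintegral_prod _ _ _ hf]
    simp only [Kernel.prodMkRight_apply]
    refine lintegral_congr fun a => ?_
    rw [Kernel.deterministic_apply, lintegral_dirac' _ (by fun_prop)]
  have hpY : ((pA.map enc).prod pN).map (fun ω => chan ω.1 ω.2)
      = (pA.prod pN).map (fun ω => chan (enc ω.1) ω.2) := by
    have : (pA.map enc).prod pN = (pA.prod pN).map (Prod.map enc id) := by
      rw [← Measure.map_prod_map _ _ henc measurable_id, Measure.map_id]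
    rw [this, Measure.map_map hc (henc.prodMap measurable_id)]
    rfl
  have hkm : ∀ f : 𝓦 × 𝓨 → ℝ≥0∞, Measurable f →
      Measurable fun q : 𝓧 × 𝓨 => ∫⁻ a, f (a, q.2) ∂(κ₀ q.1) := fun f hf =>
    Measurable.lintegral_kernel_prod_right' (κ := κ₀.prodMkRight 𝓨)
      (f := fun p : (𝓧 × 𝓨) × 𝓦 => f (p.2, p.1.2)) (by fun_prop)
  have := Measure.isProbabilityMeasure_map (μ := (pA.map enc).prod pN) hc.aemeasurable
  have := Measure.isProbabilityMeasure_map (μ := (pA.map enc).prod pN)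
    (measurable_fst.prodMk hc).aemeasurable
  have h1 : κ ∘ₘ (((pA.map enc).prod pN).map fun ω => (ω.1, chan ω.1 ω.2)) =
      (pA.prod pN).map fun ω => (ω.1, chan (enc ω.1) ω.2) := by
    refine Measure.ext_of_lintegral _ fun f hf => ?_
    rw [hκ _ f hf, lintegral_map (hkm f hf) (by fun_prop),
      lintegral_map hf (measurable_fst.prodMk hce)]
    refine (lintegral_prod_symm' _ ((hkm f hf).comp (measurable_fst.prodMk hc))).trans ?_
    rw [lintegral_prod_symm' _ (by fun_prop)]
    refine lintegral_congr fun n => ?_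
    exact hκ₀ (fun x a => f (a, chan x n)) (by fun_prop)
  have h2 : κ ∘ₘ ((((pA.map enc).prod pN).map fun ω => ω.1).prod
      (((pA.map enc).prod pN).map fun ω => chan ω.1 ω.2)) =
      ((pA.prod pN).map fun ω => ω.1).prod
        ((pA.prod pN).map fun ω => chan (enc ω.1) ω.2) := by
    have e1 : (((pA.map enc).prod pN).map fun ω => ω.1) = pA.map enc := by
      change Measure.map Prod.fst _ = _
      rw [Measure.map_fst_prod]; simp
    have e2 : ((pA.prod pN).map fun ω => ω.1) = pA := by
      change Measure.map Prod.fst _ = _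
      rw [Measure.map_fst_prod]; simp
    rw [e1, e2, ← hpY]
    refine Measure.ext_of_lintegral _ fun f hf => ?_
    rw [hκ _ f hf, lintegral_prod_symm' _ (hkm f hf), lintegral_prod_symm' _ hf]
    refine lintegral_congr fun y => ?_
    exact hκ₀ (fun x a => f (a, y)) (by fun_prop)
  unfold mutualInfo
  rw [← h1, ← h2]
  have := Measure.isProbabilityMeasure_map (μ := (pA.map enc).prod pN) measurable_fst.aemeasurable
  exact InformationTheory.klDiv_comp_right_le _ _ κ

/-- A lower bound for two layers, `w` (coarse) and `d` (refined), when some function `proj y` of the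
output depends on `w` and the noise only. The output carries at least the information that `proj y`
has about `w`, plus the mean of any decoding metric `φ` for `d` that is normalized in the sense `E_d
exp (φ w d y) ≤ 1`. The chain rule splits the divergence at the pair `(w, proj y)`; the conditional
part is bounded by Donsker–Varadhan. -/
theorem mutualInfo_superposition_le [StandardBorelSpace 𝓦] [Nonempty 𝓦] [StandardBorelSpace 𝓓]
    [Nonempty 𝓓] [StandardBorelSpace 𝓨] [Nonempty 𝓨]
    (pW : Measure 𝓦) (pD : Measure 𝓓) (pN : Measure 𝓝) [IsProbabilityMeasure pW]
    [IsProbabilityMeasure pD] [IsProbabilityMeasure pN]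
    {enc : 𝓦 → 𝓓 → 𝓧} {chan : 𝓧 → 𝓝 → 𝓨} {proj : 𝓨 → 𝓣} {coarse : 𝓦 → 𝓝 → 𝓣}
    {φ : 𝓦 → 𝓓 → 𝓨 → ℝ}
    (henc : Measurable (Function.uncurry enc)) (hchan : Measurable (Function.uncurry chan))
    (hproj : Measurable proj) (hφ : Measurable fun p : 𝓦 × 𝓓 × 𝓨 => φ p.1 p.2.1 p.2.2)
    (hcoarse : ∀ w d n, proj (chan (enc w d) n) = coarse w n)
    (hφexp : ∀ w y, ∫⁻ d, ENNReal.ofReal (Real.exp (φ w d y)) ∂pD ≤ 1)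
    (hφint : Integrable (fun ω : 𝓦 × 𝓓 × 𝓝 => φ ω.1 ω.2.1 (chan (enc ω.1 ω.2.1) ω.2.2))
      (pW.prod (pD.prod pN))) :
    mutualInfo (pW.prod pN) (fun ω => ω.1) (fun ω => coarse ω.1 ω.2) +
        ENNReal.ofReal (∫ ω, φ ω.1 ω.2.1 (chan (enc ω.1 ω.2.1) ω.2.2) ∂(pW.prod (pD.prod pN))) ≤
      mutualInfo (((pW.prod pD).map (Function.uncurry enc)).prod pN)
        (fun ω => ω.1) (fun ω => chan ω.1 ω.2) := by
  refine le_trans ?_ (mutualInfo_latent_le (pW.prod pD) pN henc hchan)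
  set y : (𝓦 × 𝓓) × 𝓝 → 𝓨 := fun ω => chan (Function.uncurry enc ω.1) ω.2 with hy
  have hym : Measurable y := hchan.comp ((henc.comp measurable_fst).prodMk measurable_snd)
  set J := (pW.prod pD).prod pN with hJ
  set pY := J.map y with hpY
  have : IsProbabilityMeasure pY := Measure.isProbabilityMeasure_map hym.aemeasurable
  let g : (𝓦 × 𝓓) × 𝓨 → (𝓦 × 𝓣) × (𝓓 × 𝓨) := fun p => ((p.1.1, proj p.2), (p.1.2, p.2))
  have hg : Measurable g := by fun_prop
  set μ' := (J.map fun ω => (ω.1, y ω)).map g with hμ'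
  have hμm : Measurable fun ω : (𝓦 × 𝓓) × 𝓝 => (ω.1, y ω) := measurable_fst.prodMk hym
  have : IsProbabilityMeasure (J.map fun ω => (ω.1, y ω)) :=
    Measure.isProbabilityMeasure_map hμm.aemeasurable
  have : IsProbabilityMeasure μ' := Measure.isProbabilityMeasure_map hg.aemeasurable
  -- under the product of the marginals, `(d, y)` given `(w, proj y)` consists of an independent `d`
  -- and of `y` drawn from its conditional law `θ` given `proj y`
  let θ : Kernel 𝓣 𝓨 := condDistrib id proj pY
  let η : Kernel (𝓦 × 𝓣) (𝓓 × 𝓨) := (Kernel.const _ pD) ×ₖ (θ.prodMkLeft 𝓦)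
  have hη : ∀ (m : Measure (𝓦 × 𝓣)) [SFinite m] (f : (𝓦 × 𝓣) × (𝓓 × 𝓨) → ℝ≥0∞), Measurable f →
      ∫⁻ p, f p ∂(m ⊗ₘ η) = ∫⁻ q, ∫⁻ z, ∫⁻ d, f (q, (d, z)) ∂pD ∂(θ q.2) ∂m := by
    intro m _ f hf
    rw [Measure.lintegral_compProd hf]
    refine lintegral_congr fun q => ?_
    simp only [η]
    rw [Kernel.prod_apply, Kernel.const_apply, Kernel.prodMkLeft_apply,
      lintegral_prod_symm' _ (by fun_prop)]
  have hpT : IsProbabilityMeasure (pY.map proj) :=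
    Measure.isProbabilityMeasure_map hproj.aemeasurable
  have hν : ((J.map fun ω => ω.1).prod pY).map g = (pW.prod (pY.map proj)) ⊗ₘ η := by
    have e1 : (J.map fun ω => ω.1) = pW.prod pD := by
      change Measure.map Prod.fst _ = _
      rw [Measure.map_fst_prod]; simp
    rw [e1]
    refine Measure.ext_of_lintegral _ fun f hf => ?_
    have hm1 : Measurable fun p : (𝓦 × 𝓣) × 𝓨 => ∫⁻ d, f (p.1, (d, p.2)) ∂pD :=
      Measurable.lintegral_prod_right' (f := fun p : ((𝓦 × 𝓣) × 𝓨) × 𝓓 => f (p.1.1, (p.2, p.1.2)))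
        (by fun_prop)
    have hm2 : Measurable fun q : 𝓦 × 𝓣 => ∫⁻ z, ∫⁻ d, f (q, (d, z)) ∂pD ∂(θ q.2) :=
      Measurable.lintegral_kernel_prod_right' (κ := θ.prodMkLeft 𝓦) hm1
    rw [hη _ f hf, lintegral_map hf hg, lintegral_prod_symm' _ (by fun_prop),
      lintegral_prod _ hm2.aemeasurable]
    have hθ : ∀ w, ∫⁻ t, ∫⁻ z, ∫⁻ d, f ((w, t), (d, z)) ∂pD ∂(θ t) ∂(pY.map proj)
        = ∫⁻ z, ∫⁻ d, f ((w, proj z), (d, z)) ∂pD ∂pY := by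
      intro w
      have h := compProd_map_condDistrib (mβ := inferInstance) (μ := pY) (X := proj) (Y := id)
        aemeasurable_id
      have hm3 : Measurable fun p : 𝓣 × 𝓨 => ∫⁻ d, f ((w, p.1), (d, p.2)) ∂pD :=
        hm1.comp (show Measurable fun p : 𝓣 × 𝓨 => ((w, p.1), p.2) by fun_prop)
      have h2 := Measure.lintegral_compProd (μ := pY.map proj) (κ := θ) hm3
      rw [← h2]
      change ∫⁻ p, _ ∂(pY.map proj ⊗ₘ condDistrib id proj pY) = _
      rw [h, lintegral_map hm3 (hproj.prodMk measurable_id)]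
      rfl
    simp only [hθ]
    have hm4 : Measurable (Function.uncurry fun (w : 𝓦) (z : 𝓨) =>
        ∫⁻ d, f ((w, proj z), (d, z)) ∂pD) :=
      hm1.comp (show Measurable fun p : 𝓦 × 𝓨 => ((p.1, proj p.2), p.2) by fun_prop)
    rw [lintegral_lintegral_swap hm4.aemeasurable]
    refine lintegral_congr fun z => ?_
    rw [lintegral_prod _ (by fun_prop)]
  have hcm : Measurable fun ω : 𝓦 × 𝓝 => coarse ω.1 ω.2 := by
    obtain ⟨d⟩ := ‹Nonempty 𝓓›
    simp only [← hcoarse _ d]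
    exact hproj.comp (hchan.comp ((henc.comp (measurable_fst.prodMk measurable_const)).prodMk
      measurable_snd))
  have hJW : J.map (fun ω => (ω.1.1, ω.2)) = pW.prod pN := by
    have h := Measure.map_prod_map (pW.prod pD) pN measurable_fst measurable_id
    rw [Measure.map_fst_prod, Measure.map_id, measure_univ, one_smul] at h
    exact h.symm
  have hfst : μ'.fst = (pW.prod pN).map fun ω => (ω.1, coarse ω.1 ω.2) := by
    rw [← hJW, Measure.map_map (measurable_fst.prodMk hcm) (by fun_prop), Measure.fst, hμ',
      Measure.map_map measurable_fst hg, Measure.map_map (by fun_prop) hμm]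
    congr 1
    funext ω
    exact congrArg (Prod.mk ω.1.1) (hcoarse _ _ _)
  have hpT' : pY.map proj = (pW.prod pN).map fun ω => coarse ω.1 ω.2 := by
    rw [← hJW, Measure.map_map hcm (by fun_prop), hpY, Measure.map_map hproj hym]
    congr 1
    funext ω
    exact hcoarse _ _ _
  have hpW : ((pW.prod pN).map fun ω => ω.1) = pW := by
    change Measure.map Prod.fst _ = _
    rw [Measure.map_fst_prod]; simp
  have hchain : InformationTheory.klDiv μ' (((J.map fun ω => ω.1).prod pY).map g) =
      InformationTheory.klDiv μ'.fst (pW.prod (pY.map proj)) +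
        InformationTheory.klDiv μ' (μ'.fst ⊗ₘ η) := by
    have h := InformationTheory.klDiv_compProd_eq_add μ'.fst (pW.prod (pY.map proj)) μ'.condKernel η
    rw [Measure.disintegrate] at h
    rw [hν, h]
  have := Measure.isProbabilityMeasure_map (μ := J) measurable_fst.aemeasurable
  unfold mutualInfo
  refine le_trans ?_ (InformationTheory.klDiv_map_le _ _ hg)
  rw [← hμ', hchain, hfst, hpT', hpW]
  gcongr
  rw [← hfst]
  have hφm : Measurable fun p : (𝓦 × 𝓣) × (𝓓 × 𝓨) => φ p.1.1 p.2.1 p.2.2 :=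
    hφ.comp
      (show Measurable fun p : (𝓦 × 𝓣) × (𝓓 × 𝓨) => (p.1.1, p.2.1, p.2.2) by fun_prop)
  have hJφ : J.map (fun ω => (ω.1.1, ω.1.2, ω.2)) = pW.prod (pD.prod pN) :=
    (measurePreserving_prodAssoc pW pD pN).map_eq
  have hm : Measurable fun ω : 𝓦 × 𝓓 × 𝓝 => φ ω.1 ω.2.1 (chan (enc ω.1 ω.2.1) ω.2.2) :=
    hφ.comp
      (measurable_fst.prodMk (measurable_snd.fst.prodMk
        (hchan.comp ((henc.comp (measurable_fst.prodMk measurable_snd.fst)).prodMk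
          measurable_snd.snd))))
  have hint : Integrable (fun p : (𝓦 × 𝓣) × (𝓓 × 𝓨) => φ p.1.1 p.2.1 p.2.2) μ' ∧
      ∫ p, φ p.1.1 p.2.1 p.2.2 ∂μ' =
        ∫ ω, φ ω.1 ω.2.1 (chan (enc ω.1 ω.2.1) ω.2.2) ∂(pW.prod (pD.prod pN)) := by
    rw [hμ', Measure.map_map hg hμm, integrable_map_measure hφm.aestronglyMeasurable
      (hg.comp hμm).aemeasurable, integral_map (hg.comp hμm).aemeasurable hφm.aestronglyMeasurable]
    rw [← hJφ] at hφint ⊢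
    rw [integrable_map_measure hm.aestronglyMeasurable (by fun_prop)] at hφint
    rw [integral_map (by fun_prop) hm.aestronglyMeasurable]
    exact ⟨hφint, rfl⟩
  rw [← hint.2]
  refine ofReal_integral_le_klDiv _ _ hφm hint.1 ?_
  rw [hη _ _ (by fun_prop)]
  calc _ ≤ ∫⁻ q, ∫⁻ z, 1 ∂(θ q.2) ∂μ'.fst :=
        lintegral_mono fun q => lintegral_mono fun z => hφexp q.1 z
    _ = 1 := by simp

end Superposition

/-! ### Complex Gaussian laws through their characteristic functions -/

theorem measurable_complexMk : Measurable fun p : ℝ × ℝ => Complex.mk p.1 p.2 :=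
  Complex.measurableEquivRealProd.symm.measurable

instance isProbabilityMeasure_scalarCN (v : ℝ≥0) : IsProbabilityMeasure (scalarCN v) :=
  Measure.isProbabilityMeasure_map measurable_complexMk.aemeasurable

instance isProbabilityMeasure_stdCN (n : ℕ) : IsProbabilityMeasure (stdCN n) := by
  unfold stdCN; infer_instance

theorem sqNorm_nonneg {n : ℕ} (x : Fin n → ℂ) : 0 ≤ sqNorm x :=
  Finset.sum_nonneg fun _ _ => sq_nonneg _

/-- Real-linear functionals on `ℂ` are of the form `z ↦ Re (t z)`. -/
theorem exists_dual_complex (L : StrongDual ℝ ℂ) : ∃ t : ℂ, ∀ z, L z = (t * z).re := by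
  refine ⟨⟨L 1, -L Complex.I⟩, fun z => ?_⟩
  have : z = z.re • (1 : ℂ) + z.im • Complex.I := by
    apply Complex.ext <;> simp
  conv_lhs => rw [this]
  rw [map_add, map_smul, map_smul]
  simp
  ring

theorem exists_dual_pi {n : ℕ} (L : StrongDual ℝ (Fin n → ℂ)) :
    ∃ t : Fin n → ℂ, ∀ v, L v = (t ⬝ᵥ v).re := by
  choose t ht using fun i => exists_dual_complex (L.comp (.single ℝ (fun _ : Fin n => ℂ) i))
  refine ⟨t, fun v => ?_⟩
  rw [← L.sum_comp_single, dotProduct, Complex.re_sum]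
  exact Finset.sum_congr rfl fun i _ => ht i (v i)

theorem charFunDual_scalarCN (v : ℝ≥0) {L : StrongDual ℝ ℂ} {t : ℂ}
    (h : ∀ z, L z = (t * z).re) :
    charFunDual (scalarCN v) L = Complex.exp ((-(v * ‖t‖ ^ 2) / 4 : ℝ)) := by
  have e : ∀ p : ℝ × ℝ, Complex.exp ((L (Complex.mk p.1 p.2) : ℂ) * Complex.I) =
      Complex.exp (((t.re : ℝ) : ℂ) * p.1 * Complex.I) *
        Complex.exp (((-t.im : ℝ) : ℂ) * p.2 * Complex.I) := by
    intro p
    rw [h, ← Complex.exp_add]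
    congr 1
    simp only [Complex.mul_re]
    push_cast
    ring
  rw [charFunDual_apply, scalarCN, integral_map measurable_complexMk.aemeasurable
    (by fun_prop)]
  simp only [e]
  rw [integral_prod_mul (μ := gaussianReal 0 (v / 2)) (ν := gaussianReal 0 (v / 2))
    (fun x : ℝ => Complex.exp (((t.re : ℝ) : ℂ) * x * Complex.I))
    (fun x : ℝ => Complex.exp (((-t.im : ℝ) : ℂ) * x * Complex.I))]
  rw [← charFun_apply_real, ← charFun_apply_real, charFun_gaussianReal, charFun_gaussianReal,
    ← Complex.exp_add]
  congr 1
  rw [Complex.sq_norm, Complex.normSq_apply]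
  push_cast
  ring

theorem charFunDual_stdCN {n : ℕ} {L : StrongDual ℝ (Fin n → ℂ)} {t : Fin n → ℂ}
    (h : ∀ v, L v = (t ⬝ᵥ v).re) :
    charFunDual (stdCN n) L = Complex.exp ((-(sqNorm t) / 4 : ℝ)) := by
  rw [stdCN, charFunDual_pi]
  have : ∀ i, charFunDual (scalarCN 1) (L.comp (.single ℝ (fun _ : Fin n => ℂ) i)) =
      Complex.exp ((-(‖t i‖ ^ 2) / 4 : ℝ)) := by
    intro i
    rw [charFunDual_scalarCN 1 (t := t i)]
    · simp
    · intro z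
      simp [h, dotProduct_single]
  simp only [this]
  rw [← Complex.exp_sum, ← Complex.ofReal_sum, ← Finset.sum_div, Finset.sum_neg_distrib]
  rfl

theorem sqNorm_eq_dotProduct {n : ℕ} (x : Fin n → ℂ) : (sqNorm x : ℂ) = star x ⬝ᵥ x := by
  simp [sqNorm, dotProduct, Complex.conj_mul', Complex.ofReal_sum]

theorem sqNorm_eq_re {n : ℕ} (x : Fin n → ℂ) : sqNorm x = (star x ⬝ᵥ x).re := by
  rw [← sqNorm_eq_dotProduct]; simp

theorem sqNorm_eq_re' {n : ℕ} (x : Fin n → ℂ) : sqNorm x = (x ⬝ᵥ star x).re := by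
  rw [sqNorm_eq_re, dotProduct_comm]

theorem sqNorm_star {n : ℕ} (x : Fin n → ℂ) : sqNorm (star x) = sqNorm x := by
  simp [sqNorm]

theorem sqNorm_smul {n : ℕ} (c : ℂ) (x : Fin n → ℂ) : sqNorm (c • x) = ‖c‖ ^ 2 * sqNorm x := by
  simp [sqNorm, mul_pow, Finset.mul_sum]

theorem continuous_sqNorm {n : ℕ} : Continuous (sqNorm (n := n)) := by
  unfold sqNorm; fun_prop

/-- A linear functional of a standard complex Gaussian vector is a scalar complex Gaussian. -/
theorem map_dotProduct_stdCN {n : ℕ} (a : Fin n → ℂ) :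
    (stdCN n).map (fun u => a ⬝ᵥ u) = scalarCN (sqNorm a).toNNReal := by
  let T : (Fin n → ℂ) →L[ℝ] ℂ :=
    { toFun := fun u => a ⬝ᵥ u
      map_add' := fun u v => dotProduct_add a u v
      map_smul' := fun c u => dotProduct_smul c a u
      cont := by unfold dotProduct; fun_prop }
  have := Measure.isProbabilityMeasure_map (μ := stdCN n) T.continuous.measurable.aemeasurable
  change (stdCN n).map T = _
  apply Measure.ext_of_charFunDual
  ext L
  obtain ⟨t, ht⟩ := exists_dual_complex L
  rw [charFunDual_map, charFunDual_scalarCN _ ht, charFunDual_stdCN (t := t • a)]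
  · rw [sqNorm_smul, Real.coe_toNNReal _ (sqNorm_nonneg a), mul_comm]
  · intro v
    simp [ht, T]

/-- Unitary invariance of `CN(0, I)`. -/
theorem map_mulVec_stdCN {n : ℕ} {W : Matrix (Fin n) (Fin n) ℂ} (hW : W * Wᴴ = 1) :
    (stdCN n).map (fun u => W *ᵥ u) = stdCN n := by
  let T : (Fin n → ℂ) →L[ℝ] (Fin n → ℂ) :=
    { toFun := fun u => W *ᵥ u
      map_add' := fun u v => Matrix.mulVec_add W u v
      map_smul' := fun c u => Matrix.mulVec_smul W c u
      cont := by fun_prop }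
  have := Measure.isProbabilityMeasure_map (μ := stdCN n) T.continuous.measurable.aemeasurable
  change (stdCN n).map T = _
  apply Measure.ext_of_charFunDual
  ext L
  obtain ⟨t, ht⟩ := exists_dual_pi L
  rw [charFunDual_map, charFunDual_stdCN ht, charFunDual_stdCN (t := t ᵥ* W)]
  · have : sqNorm (t ᵥ* W) = sqNorm t := by
      rw [sqNorm_eq_re', sqNorm_eq_re', Matrix.star_vecMul, ← Matrix.dotProduct_mulVec,
        Matrix.mulVec_mulVec, hW, Matrix.one_mulVec]
    rw [this]
  · intro v
    simp [ht, T, Matrix.dotProduct_mulVec]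

/-! ### Second moments -/

theorem lintegral_sq_scalarCN (v : ℝ≥0) (p : ℂ) :
    ∫⁻ z, ENNReal.ofReal (‖p + z‖ ^ 2) ∂(scalarCN v) = ENNReal.ofReal (‖p‖ ^ 2 + v) := by
  have hg : ∀ a : ℝ, ∫⁻ x, ENNReal.ofReal ((a + x) ^ 2) ∂(gaussianReal 0 (v / 2)) =
      ENNReal.ofReal (a ^ 2 + v / 2) := by
    intro a
    have hvar := variance_fun_id_gaussianReal (μ := a) (v := v / 2)
    have hmem := memLp_id_gaussianReal (μ := a) (v := v / 2) 2
    have hi : Integrable (fun x : ℝ => x ^ 2) (gaussianReal a (v / 2)) := by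
      simpa using hmem.integrable_sq
    have h2 : ∫ x, x ^ 2 ∂(gaussianReal a (v / 2)) = a ^ 2 + v / 2 := by
      have := variance_eq_sub (μ := gaussianReal a (v / 2)) hmem
      simp [integral_id_gaussianReal] at this
      have h3 : ∫ x, x ^ 2 ∂(gaussianReal a (v / 2)) =
          ∫ x, (id ^ 2 : ℝ → ℝ) x ∂(gaussianReal a (v / 2)) := rfl
      rw [h3]
      linarith
    have hmap : (gaussianReal 0 (v / 2)).map (a + ·) = gaussianReal a (v / 2) := by
      rw [gaussianReal_map_const_add]; simp
    rw [← h2, ofReal_integral_eq_lintegral_ofReal hi (ae_of_all _ fun x => sq_nonneg x), ← hmap,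
      lintegral_map (by fun_prop) (by fun_prop)]
  rw [scalarCN, lintegral_map (by fun_prop) measurable_complexMk]
  have e : ∀ q : ℝ × ℝ, ENNReal.ofReal (‖p + Complex.mk q.1 q.2‖ ^ 2) =
      ENNReal.ofReal ((p.re + q.1) ^ 2) + ENNReal.ofReal ((p.im + q.2) ^ 2) := by
    intro q
    rw [← ENNReal.ofReal_add (sq_nonneg _) (sq_nonneg _), Complex.sq_norm, Complex.normSq_apply]
    congr 1
    simp
    ring
  simp only [e]
  rw [lintegral_add_left (by fun_prop),
    lintegral_prod _ (by fun_prop), lintegral_prod_symm' _ (by fun_prop)]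
  simp only [lintegral_const, measure_univ, mul_one, hg]
  rw [← ENNReal.ofReal_add (by positivity) (by positivity), Complex.sq_norm, Complex.normSq_apply]
  congr 1
  ring

/-- The squared Frobenius norm of a matrix, as the sum of the squared norms of its rows. -/
def frobSq {m n : ℕ} (A : Matrix (Fin m) (Fin n) ℂ) : ℝ := ∑ i, sqNorm (A.row i)

theorem frobSq_nonneg {m n : ℕ} (A : Matrix (Fin m) (Fin n) ℂ) : 0 ≤ frobSq A :=
  Finset.sum_nonneg fun _ _ => sqNorm_nonneg _

theorem frobSq_eq_trace {m n : ℕ} (A : Matrix (Fin m) (Fin n) ℂ) :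
    frobSq A = (A * Aᴴ).trace.re := by
  simp only [frobSq, sqNorm_eq_re', Matrix.trace, Complex.re_sum]
  rfl

theorem lintegral_sqNorm_stdCN {m n : ℕ} (p : Fin m → ℂ) (A : Matrix (Fin m) (Fin n) ℂ) :
    ∫⁻ u, ENNReal.ofReal (sqNorm (p + A *ᵥ u)) ∂(stdCN n) =
      ENNReal.ofReal (sqNorm p + frobSq A) := by
  have e : ∀ u : Fin n → ℂ, ENNReal.ofReal (sqNorm (p + A *ᵥ u)) =
      ∑ i, ENNReal.ofReal (‖p i + A.row i ⬝ᵥ u‖ ^ 2) := by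
    intro u
    rw [sqNorm, ENNReal.ofReal_sum_of_nonneg fun _ _ => sq_nonneg _]
    rfl
  have hd : ∀ i, Measurable fun u => A.row i ⬝ᵥ u := fun i =>
    Continuous.measurable (by unfold dotProduct; fun_prop)
  simp only [e]
  rw [lintegral_finsetSum _ fun i _ => by have := hd i; fun_prop]
  have h : ∀ i, ∫⁻ u, ENNReal.ofReal (‖p i + A.row i ⬝ᵥ u‖ ^ 2) ∂(stdCN n) =
      ENNReal.ofReal (‖p i‖ ^ 2 + sqNorm (A.row i)) := by
    intro i
    have h1 := lintegral_sq_scalarCN (sqNorm (A.row i)).toNNReal (p i)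
    rw [Real.coe_toNNReal _ (sqNorm_nonneg _), ← map_dotProduct_stdCN,
      lintegral_map (by fun_prop) (hd i)] at h1
    exact h1
  simp only [h]
  rw [← ENNReal.ofReal_sum_of_nonneg fun i _ => add_nonneg (sq_nonneg _) (sqNorm_nonneg _),
    Finset.sum_add_distrib]
  rfl

/-! ### Independence of estimate, estimation error and noise -/

/-- Let `s ∼ CN(0, v)` and `z ∼ CN(0, I)` be independent and `α + α' = 1`. If `‖β‖² = v α α'`, then
the estimate `α s + βᵀ z` of `s` and its error `α' s - βᵀ z` are uncorrelated, hence independent; if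
moreover `β` is orthogonal to the (conjugated) columns of `U`, both are independent of `Uᴴ z`. -/
theorem map_estimate_error_noise {N k : ℕ} (v α α' : ℝ≥0) (h1 : α + α' = 1)
    {U : Matrix (Fin N) (Fin k) ℂ}
    (hU : Uᴴ * U = 1) {β : Fin N → ℂ} (hβ : Uᴴ *ᵥ star β = 0)
    (hα : (v : ℝ) * α * α' = sqNorm β) :
    ((scalarCN v).prod (stdCN N)).map
        (fun p => (((α : ℝ) : ℂ) * p.1 + β ⬝ᵥ p.2, ((α' : ℝ) : ℂ) * p.1 - β ⬝ᵥ p.2, Uᴴ *ᵥ p.2)) =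
      (scalarCN (v * α)).prod ((scalarCN (v * α')).prod (stdCN k)) := by
  let T : (ℂ × (Fin N → ℂ)) →L[ℝ] (ℂ × ℂ × (Fin k → ℂ)) :=
    { toFun := fun p => (((α : ℝ) : ℂ) * p.1 + β ⬝ᵥ p.2, ((α' : ℝ) : ℂ) * p.1 - β ⬝ᵥ p.2,
        Uᴴ *ᵥ p.2)
      map_add' := fun p q => by
        simp only [Prod.fst_add, Prod.snd_add, dotProduct_add, Matrix.mulVec_add, Prod.mk_add_mk,
          Prod.mk.injEq, and_true]
        constructor <;> ring
      map_smul' := fun c p => by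
        simp only [Prod.smul_fst, Prod.smul_snd, dotProduct_smul, Matrix.mulVec_smul,
          Prod.smul_mk, RingHom.id_apply, smul_add, smul_sub, mul_smul_comm]
      cont := by unfold dotProduct; fun_prop }
  have := Measure.isProbabilityMeasure_map (μ := (scalarCN v).prod (stdCN N))
    T.continuous.measurable.aemeasurable
  change ((scalarCN v).prod (stdCN N)).map T = _
  apply Measure.ext_of_charFunDual
  ext L
  obtain ⟨t₁, ht₁⟩ := exists_dual_complex (L.comp (.inl ℝ ℂ (ℂ × (Fin k → ℂ))))
  obtain ⟨t₂, ht₂⟩ := exists_dual_complex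
    ((L.comp (.inr ℝ ℂ (ℂ × (Fin k → ℂ)))).comp (.inl ℝ ℂ (Fin k → ℂ)))
  obtain ⟨t₃, ht₃⟩ := exists_dual_pi
    ((L.comp (.inr ℝ ℂ (ℂ × (Fin k → ℂ)))).comp (.inr ℝ ℂ (Fin k → ℂ)))
  have hL : ∀ x y w, L (x, y, w) = (t₁ * x + t₂ * y + t₃ ⬝ᵥ w).re := by
    intro x y w
    rw [Complex.add_re, Complex.add_re, ← ht₁, ← ht₂, ← ht₃]
    simp [← map_add]
  rw [charFunDual_map, charFunDual_prod, charFunDual_prod, charFunDual_prod,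
    charFunDual_scalarCN _ ht₁, charFunDual_scalarCN _ ht₂, charFunDual_stdCN ht₃,
    charFunDual_scalarCN v (t := α * t₁ + α' * t₂),
    charFunDual_stdCN (t := (t₁ - t₂) • β + t₃ ᵥ* Uᴴ)]
  · rw [← Complex.exp_add, ← Complex.exp_add, ← Complex.exp_add]
    congr 1
    have e1 : (t₃ ᵥ* Uᴴ) ⬝ᵥ star β = 0 := by
      rw [← Matrix.dotProduct_mulVec, hβ, dotProduct_zero]
    have e2 : β ⬝ᵥ star (t₃ ᵥ* Uᴴ) = 0 := by
      rw [← star_star β, Matrix.star_dotProduct_star, e1, star_zero]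
    have e3 : sqNorm (t₃ ᵥ* Uᴴ) = sqNorm t₃ := by
      rw [sqNorm_eq_re', sqNorm_eq_re', Matrix.star_vecMul, ← Matrix.dotProduct_mulVec,
        Matrix.mulVec_mulVec, Matrix.conjTranspose_conjTranspose, hU, Matrix.one_mulVec]
    have e4 : sqNorm ((t₁ - t₂) • β + t₃ ᵥ* Uᴴ) = ‖t₁ - t₂‖ ^ 2 * sqNorm β + sqNorm t₃ := by
      rw [← sqNorm_smul, ← e3, sqNorm_eq_re', sqNorm_eq_re', sqNorm_eq_re' (t₃ ᵥ* Uᴴ)]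
      simp only [star_add, add_dotProduct, dotProduct_add, star_smul, smul_dotProduct,
        dotProduct_smul, e1, e2, smul_zero, add_zero, zero_add, Complex.add_re]
    have e5 : (α' : ℝ) = 1 - α := by
      have : ((α + α' : ℝ≥0) : ℝ) = 1 := by rw [h1]; rfl
      push_cast at this
      linarith
    rw [e4, ← hα]
    norm_cast
    simp only [Complex.sq_norm, Complex.normSq_apply]
    simp [e5]
    ring
  · intro z
    simp only [T, ContinuousLinearMap.comp_apply, ContinuousLinearMap.inr_apply]
    change L (_, _, _) = _
    rw [hL]
    congr 1
    simp only [add_dotProduct, smul_dotProduct, ← Matrix.dotProduct_mulVec, smul_eq_mul]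
    ring
  · intro z
    simp only [T, ContinuousLinearMap.comp_apply, ContinuousLinearMap.inl_apply]
    change L (_, _, _) = _
    rw [hL]
    congr 1
    simp only [dotProduct_zero, Matrix.mulVec_zero]
    ring

/-! ### A Gaussian integral -/

theorem integral_exp_gaussianReal_half {l : ℝ} (hl : 0 < l) (a : ℝ) :
    ∫ x, Real.exp (x ^ 2 - l * (x - a) ^ 2) ∂(gaussianReal 0 (1 / 2)) = (√l)⁻¹ := by
  rw [integral_gaussianReal_eq_integral_smul (by norm_num)]
  have e : ∀ x : ℝ, gaussianPDFReal 0 (1 / 2) x • Real.exp (x ^ 2 - l * (x - a) ^ 2) =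
      (√Real.pi)⁻¹ * Real.exp (-l * (x - a) ^ 2) := by
    intro x
    rw [gaussianPDFReal_def, smul_eq_mul, mul_assoc, ← Real.exp_add]
    congr 3
    · push_cast; ring
    · push_cast; ring
  simp only [e]
  rw [integral_const_mul, integral_sub_right_eq_self (fun x => Real.exp (-l * x ^ 2)) a,
    integral_gaussian, Real.sqrt_div Real.pi_pos.le]
  have := Real.sqrt_pos.2 Real.pi_pos
  field_simp

theorem integral_exp_scalarCN {l : ℝ} (hl : 0 < l) (c : ℂ) :
    ∫ z, Real.exp (‖z‖ ^ 2 - l * ‖z - c‖ ^ 2) ∂(scalarCN 1) = l⁻¹ := by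
  rw [scalarCN, integral_map measurable_complexMk.aemeasurable
    (Continuous.aestronglyMeasurable (by fun_prop))]
  have e : ∀ p : ℝ × ℝ, Real.exp (‖Complex.mk p.1 p.2‖ ^ 2 - l * ‖Complex.mk p.1 p.2 - c‖ ^ 2) =
      Real.exp (p.1 ^ 2 - l * (p.1 - c.re) ^ 2) * Real.exp (p.2 ^ 2 - l * (p.2 - c.im) ^ 2) := by
    intro p
    rw [← Real.exp_add, Complex.sq_norm, Complex.normSq_apply, Complex.sq_norm,
      Complex.normSq_apply]
    congr 1
    simp
    ring
  simp only [e]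
  rw [integral_prod_mul (μ := gaussianReal 0 (1 / 2)) (ν := gaussianReal 0 (1 / 2))
    (fun x : ℝ => Real.exp (x ^ 2 - l * (x - c.re) ^ 2))
    (fun x : ℝ => Real.exp (x ^ 2 - l * (x - c.im) ^ 2)),
    integral_exp_gaussianReal_half hl, integral_exp_gaussianReal_half hl, ← mul_inv,
    Real.mul_self_sqrt hl.le]

/-- The Gaussian integral that normalizes the refined decoding metric. It is reduced to scalar
integrals by diagonalizing `M`, using unitary invariance. -/
theorem lintegral_exp_stdCN {n : ℕ} {M : Matrix (Fin n) (Fin n) ℂ} (hM : M.PosDef)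
    (c : Fin n → ℂ) :
    ∫⁻ u, ENNReal.ofReal (Real.exp (sqNorm u - (star (u - c) ⬝ᵥ (M *ᵥ (u - c))).re)) ∂(stdCN n) =
      ENNReal.ofReal (M.det.re)⁻¹ := by
  set W : Matrix (Fin n) (Fin n) ℂ := hM.isHermitian.eigenvectorUnitary.val with hW
  set l := hM.isHermitian.eigenvalues with hl
  have hlpos : ∀ i, 0 < l i := hM.eigenvalues_pos
  have hWW : W * Wᴴ = 1 := Unitary.mul_star_self_of_mem (SetLike.coe_mem _)
  have hWW' : Wᴴ * W = 1 := Unitary.star_mul_self_of_mem (SetLike.coe_mem _)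
  have hspec : M = W * Matrix.diagonal (fun i => (l i : ℂ)) * Wᴴ := by
    have := hM.isHermitian.spectral_theorem
    rw [Unitary.conjStarAlgAut_apply] at this
    exact this
  have hdet : M.det.re = ∏ i, l i := by
    rw [hM.isHermitian.det_eq_prod_eigenvalues]
    simp only [Complex.coe_algebraMap, ← Complex.ofReal_prod]
    exact Complex.ofReal_re _
  set c' := Wᴴ *ᵥ c with hc'
  have hm : Measurable fun u : Fin n → ℂ => W *ᵥ u := Continuous.measurable (by fun_prop)
  have hcont : Continuous fun u : Fin n → ℂ =>
      Real.exp (sqNorm u - (star (u - c) ⬝ᵥ (M *ᵥ (u - c))).re) := by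
    have := continuous_sqNorm (n := n)
    unfold dotProduct; fun_prop
  have hq : ∀ u : Fin n → ℂ,
      Real.exp (sqNorm (W *ᵥ u) - (star (W *ᵥ u - c) ⬝ᵥ (M *ᵥ (W *ᵥ u - c))).re) =
        ∏ i, Real.exp (‖u i‖ ^ 2 - l i * ‖u i - c' i‖ ^ 2) := by
    intro u
    have e1 : W *ᵥ u - c = W *ᵥ (u - c') := by
      rw [Matrix.mulVec_sub, hc', Matrix.mulVec_mulVec, hWW, Matrix.one_mulVec]
    have e2 : sqNorm (W *ᵥ u) = sqNorm u := by
      rw [sqNorm_eq_re, sqNorm_eq_re, Matrix.star_mulVec, ← Matrix.dotProduct_mulVec,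
        Matrix.mulVec_mulVec, hWW', Matrix.one_mulVec]
    have e3 : star (W *ᵥ (u - c')) ⬝ᵥ (M *ᵥ (W *ᵥ (u - c'))) =
        star (u - c') ⬝ᵥ (Matrix.diagonal (fun i => (l i : ℂ)) *ᵥ (u - c')) := by
      rw [Matrix.star_mulVec, ← Matrix.dotProduct_mulVec, Matrix.mulVec_mulVec,
        Matrix.mulVec_mulVec]
      congr 2
      rw [hspec]
      calc _ = (Wᴴ * W) * Matrix.diagonal (fun i => (l i : ℂ)) * (Wᴴ * W) := by
            simp only [Matrix.mul_assoc]
        _ = _ := by rw [hWW', Matrix.one_mul, Matrix.mul_one]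
    rw [e1, e2, e3, ← Real.exp_sum, Finset.sum_sub_distrib]
    congr 2
    simp only [dotProduct, Matrix.mulVec_diagonal, Complex.re_sum]
    refine Finset.sum_congr rfl fun i _ => ?_
    rw [Complex.sq_norm, Complex.normSq_apply]
    simp
    ring
  have hint : ∫ u, Real.exp (sqNorm u - (star (u - c) ⬝ᵥ (M *ᵥ (u - c))).re) ∂(stdCN n) =
      (M.det.re)⁻¹ := by
    rw [← map_mulVec_stdCN hWW, integral_map hm.aemeasurable
      hcont.aestronglyMeasurable]
    simp only [hq]
    rw [stdCN, integral_fintype_prod_eq_prod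
      (fun i z => Real.exp (‖z‖ ^ 2 - l i * ‖z - c' i‖ ^ 2)), hdet, ← Finset.prod_inv_distrib]
    exact Finset.prod_congr rfl fun i _ => integral_exp_scalarCN (hlpos i) _
  have hpos : 0 < M.det.re := hdet ▸ Finset.prod_pos fun i _ => hlpos i
  rw [← hint, ofReal_integral_eq_lintegral_ofReal]
  · -- a non-integrable function would have Bochner integral zero
    by_contra h
    rw [integral_undef h] at hint
    exact (inv_pos.2 hpos).ne hint
  · exact ae_of_all _ fun u => (Real.exp_pos _).le

/-! ### Positive semidefinite matrices -/

theorem det_one_add_eq_prod {k : ℕ} {P : Matrix (Fin k) (Fin k) ℂ} (hP : P.PosSemidef) :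
    (1 + P).det.re = ∏ i, (1 + hP.isHermitian.eigenvalues i) := by
  set W : Matrix (Fin k) (Fin k) ℂ := hP.isHermitian.eigenvectorUnitary.val with hW
  set l := hP.isHermitian.eigenvalues with hl
  have hWW : W * Wᴴ = 1 := Unitary.mul_star_self_of_mem (SetLike.coe_mem _)
  have hspec : P = W * Matrix.diagonal (fun i => (l i : ℂ)) * Wᴴ := by
    have := hP.isHermitian.spectral_theorem
    rw [Unitary.conjStarAlgAut_apply] at this
    exact this
  have h1 : 1 + P = W * Matrix.diagonal (fun i => ((1 + l i : ℝ) : ℂ)) * Wᴴ := by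
    have : Matrix.diagonal (fun i => ((1 + l i : ℝ) : ℂ)) =
        1 + Matrix.diagonal (fun i => (l i : ℂ)) := by
      rw [← Matrix.diagonal_one, Matrix.diagonal_add]
      congr 1
      funext i
      push_cast
      rfl
    rw [this, Matrix.mul_add, Matrix.add_mul, ← hspec, Matrix.mul_one, hWW]
  rw [h1, Matrix.det_mul_right_comm, hWW, Matrix.one_mul, Matrix.det_diagonal,
    ← Complex.ofReal_prod, Complex.ofReal_re]

theorem one_le_det_one_add {k : ℕ} {P : Matrix (Fin k) (Fin k) ℂ} (hP : P.PosSemidef) :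
    1 ≤ (1 + P).det.re := by
  rw [det_one_add_eq_prod hP]
  exact Finset.one_le_prod fun i _ => by linarith [hP.eigenvalues_nonneg i]

theorem log_det_one_add_le {k : ℕ} {P : Matrix (Fin k) (Fin k) ℂ} (hP : P.PosSemidef) :
    Real.log (1 + P).det.re ≤ P.trace.re := by
  have htr : P.trace.re = ∑ i, hP.isHermitian.eigenvalues i := by
    rw [hP.isHermitian.trace_eq_sum_eigenvalues]
    simp
  rw [htr, det_one_add_eq_prod hP, Real.log_prod fun i _ => by
    linarith [hP.eigenvalues_nonneg i]]
  refine Finset.sum_le_sum fun i _ => ?_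
  linarith [Real.log_le_sub_one_of_pos
    (show 0 < 1 + hP.isHermitian.eigenvalues i by linarith [hP.eigenvalues_nonneg i])]

theorem conjTranspose_sqrt {k : ℕ} (Q : Matrix (Fin k) (Fin k) ℂ) :
    (CFC.sqrt Q)ᴴ = CFC.sqrt Q :=
  (CFC.sqrt_nonneg Q).isSelfAdjoint

theorem sqrt_mul_sqrt {k : ℕ} {Q : Matrix (Fin k) (Fin k) ℂ} (hQ : Q.PosSemidef) :
    CFC.sqrt Q * CFC.sqrt Q = Q :=
  CFC.sqrt_mul_sqrt_self Q hQ.nonneg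

/-- Inversion is continuous along a family of positive definite matrices. -/
theorem continuous_matrix_inv {X : Type*} [TopologicalSpace X] {n : ℕ}
    {A : X → Matrix (Fin n) (Fin n) ℂ} (hA : Continuous A) (h : ∀ x, (A x).PosDef) :
    Continuous fun x => (A x)⁻¹ := by
  simp only [Matrix.inv_def, Ring.inverse_eq_inv']
  exact (hA.matrix_det.inv₀ fun x => (h x).det_pos.ne').smul hA.matrix_adjugate

/-! ### Linear estimation of a Gaussian vector -/

section Estimation

theorem lintegral_sqNorm_scalarCN {k : ℕ} (b : ℝ≥0) (p q : Fin k → ℂ) :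
    ∫⁻ e, ENNReal.ofReal (sqNorm (p + e • q)) ∂(scalarCN b) =
      ENNReal.ofReal (sqNorm p + b * sqNorm q) := by
  have h : ∀ i, ∫⁻ e, ENNReal.ofReal (‖p i + e * q i‖ ^ 2) ∂(scalarCN b) =
      ENNReal.ofReal (‖p i‖ ^ 2 + b * ‖q i‖ ^ 2) := by
    intro i
    by_cases hq : q i = 0
    · simp [hq]
    have hq' : ‖q i‖ ^ 2 ≠ 0 := pow_ne_zero 2 (norm_ne_zero_iff.2 hq)
    have e1 : ∀ e : ℂ, ENNReal.ofReal (‖p i + e * q i‖ ^ 2) =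
        ENNReal.ofReal (‖q i‖ ^ 2) * ENNReal.ofReal (‖p i / q i + e‖ ^ 2) := by
      intro e
      rw [← ENNReal.ofReal_mul (sq_nonneg _), ← mul_pow, ← norm_mul]
      congr 3
      field_simp
    simp only [e1]
    rw [lintegral_const_mul _ (by fun_prop), lintegral_sq_scalarCN,
      ← ENNReal.ofReal_mul (sq_nonneg _)]
    congr 1
    rw [norm_div, div_pow]
    field_simp
  simp only [sqNorm, Pi.add_apply, Pi.smul_apply, smul_eq_mul]
  simp only [ENNReal.ofReal_sum_of_nonneg fun _ _ => sq_nonneg _]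
  rw [lintegral_finsetSum _ fun i _ => by fun_prop]
  simp only [h]
  rw [← ENNReal.ofReal_sum_of_nonneg fun i _ => by positivity, Finset.sum_add_distrib,
    Finset.mul_sum]

variable {m k : ℕ}

theorem frobSq_eq_trace' (A : Matrix (Fin m) (Fin k) ℂ) :
    frobSq A = (Aᴴ * A).trace.re := by
  rw [frobSq_eq_trace, Matrix.trace_mul_comm]

/-- The covariance `I + b (a aᴴ + C Cᴴ)` of the noise `e (a + C u) + ζ`, where `e ∼ CN(0, b)`, `u ∼
CN(0, I)` and `ζ ∼ CN(0, I)` are independent. -/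
def effCov (b : ℝ≥0) (a : Fin m → ℂ) (C : Matrix (Fin m) (Fin k) ℂ) : Matrix (Fin m) (Fin m) ℂ :=
  1 + ((b : ℝ) : ℂ) • (Matrix.vecMulVec a (star a) + C * Cᴴ)

/-- The matrix `Hᴴ R⁻¹ H` of the linear model with channel `H` and noise covariance `R`. -/
def snrMatrix (R : Matrix (Fin m) (Fin m) ℂ) (H : Matrix (Fin m) (Fin k) ℂ) :
    Matrix (Fin k) (Fin k) ℂ := Hᴴ * R⁻¹ * H

/-- The LMMSE filter `(I + Hᴴ R⁻¹ H)⁻¹ Hᴴ R⁻¹` that estimates `u` of covariance `I` from `H u` plus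
noise of covariance `R`. -/
def lmmse (R : Matrix (Fin m) (Fin m) ℂ) (H : Matrix (Fin m) (Fin k) ℂ) :
    Matrix (Fin k) (Fin m) ℂ := (1 + snrMatrix R H)⁻¹ * (Hᴴ * R⁻¹)

theorem posSemidef_smul_vecMulVec_add (b : ℝ≥0) (a : Fin m → ℂ) (C : Matrix (Fin m) (Fin k) ℂ) :
    (((b : ℝ) : ℂ) • (Matrix.vecMulVec a (star a) + C * Cᴴ)).PosSemidef :=
  ((Matrix.posSemidef_vecMulVec_self_star a).add (Matrix.posSemidef_self_mul_conjTranspose C)).smul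
    (by exact_mod_cast b.coe_nonneg)

theorem posDef_effCov (b : ℝ≥0) (a : Fin m → ℂ) (C : Matrix (Fin m) (Fin k) ℂ) :
    (effCov b a C).PosDef :=
  Matrix.PosDef.one.add_posSemidef (posSemidef_smul_vecMulVec_add b a C)

theorem posSemidef_snrMatrix {R : Matrix (Fin m) (Fin m) ℂ} (hR : R.PosDef)
    (H : Matrix (Fin m) (Fin k) ℂ) : (snrMatrix R H).PosSemidef :=
  hR.inv.posSemidef.conjTranspose_mul_mul_same H

theorem posDef_one_add_snrMatrix {R : Matrix (Fin m) (Fin m) ℂ} (hR : R.PosDef)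
    (H : Matrix (Fin m) (Fin k) ℂ) : (1 + snrMatrix R H).PosDef :=
  Matrix.PosDef.one.add_posSemidef (posSemidef_snrMatrix hR H)

/-- Since `R ≥ I`, noise of covariance `R` is no better than white noise. -/
theorem trace_snrMatrix_le (b : ℝ≥0) (a : Fin m → ℂ) (C H : Matrix (Fin m) (Fin k) ℂ) :
    (snrMatrix (effCov b a C) H).trace.re ≤ frobSq H := by
  set R := effCov b a C with hR
  have hRd := posDef_effCov b a C
  set Q := (((b : ℝ) : ℂ) • (Matrix.vecMulVec a (star a) + C * Cᴴ)) with hQ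
  have hQp : Q.PosSemidef := posSemidef_smul_vecMulVec_add b a C
  have hRQ : R = 1 + Q := rfl
  have hdet : IsUnit R.det := (Matrix.isUnit_iff_isUnit_det _).1 hRd.isUnit
  have h1 : (1 - R⁻¹).PosSemidef := by
    -- `R` commutes with `Q = R - I`, so `I - R⁻¹ = R⁻¹ Q = R⁻¹ (Q + Q²) R⁻¹`
    have e : 1 - R⁻¹ = (R⁻¹)ᴴ * (Q + Qᴴ * Q) * R⁻¹ := by
      rw [hRd.inv.isHermitian.eq, hQp.isHermitian.eq]
      have : Q + Q * Q = R * Q := by rw [hRQ]; noncomm_ring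
      rw [this, ← Matrix.mul_assoc, Matrix.nonsing_inv_mul _ hdet, Matrix.one_mul]
      have : Q = R - 1 := by rw [hRQ]; simp
      rw [this, Matrix.sub_mul, Matrix.mul_nonsing_inv _ hdet, Matrix.one_mul]
    rw [e]
    exact (hQp.add (Matrix.posSemidef_conjTranspose_mul_self Q)).conjTranspose_mul_mul_same _
  have h2 := (h1.conjTranspose_mul_mul_same H).trace_nonneg
  have h3 : Hᴴ * (1 - R⁻¹) * H = Hᴴ * H - snrMatrix R H := by
    rw [snrMatrix, Matrix.mul_sub, Matrix.sub_mul, Matrix.mul_one]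
  rw [h3, Matrix.trace_sub] at h2
  have := (Complex.le_def.1 h2).1
  simp at this
  rw [frobSq_eq_trace']
  exact this

/-- The error covariance of the LMMSE filter `B`: `(I - B H)(I - B H)ᴴ + B R Bᴴ = (I + Hᴴ R⁻¹ H)⁻¹`.
-/
theorem lmmse_error {R : Matrix (Fin m) (Fin m) ℂ} (hR : R.PosDef)
    (H : Matrix (Fin m) (Fin k) ℂ) :
    (1 - lmmse R H * H) * (1 - lmmse R H * H)ᴴ + lmmse R H * R * (lmmse R H)ᴴ =
      (1 + snrMatrix R H)⁻¹ := by
  set M := 1 + snrMatrix R H with hM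
  have hMd : M.PosDef := posDef_one_add_snrMatrix hR H
  have hdet : IsUnit M.det := (Matrix.isUnit_iff_isUnit_det _).1 hMd.isUnit
  have hdetR : IsUnit R.det := (Matrix.isUnit_iff_isUnit_det _).1 hR.isUnit
  have hS : Hᴴ * R⁻¹ * H = M - 1 := by rw [hM, snrMatrix]; simp
  have hMi : (M⁻¹)ᴴ = M⁻¹ := hMd.inv.isHermitian.eq
  have hRi : (R⁻¹)ᴴ = R⁻¹ := hR.inv.isHermitian.eq
  have h1 : 1 - lmmse R H * H = M⁻¹ := by
    rw [lmmse, ← hM, Matrix.mul_assoc, hS, Matrix.mul_sub, Matrix.nonsing_inv_mul _ hdet]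
    simp
  have h2 : lmmse R H * R * (lmmse R H)ᴴ = M⁻¹ * (M - 1) * M⁻¹ := by
    rw [lmmse, ← hM, ← hS, Matrix.conjTranspose_mul, Matrix.conjTranspose_mul, hMi, hRi,
      Matrix.conjTranspose_conjTranspose]
    calc _ = M⁻¹ * Hᴴ * (R⁻¹ * R) * R⁻¹ * H * M⁻¹ := by simp only [Matrix.mul_assoc]
      _ = _ := by rw [Matrix.nonsing_inv_mul _ hdetR]; simp only [Matrix.mul_assoc, Matrix.one_mul]
  rw [h1, h2, hMi, ← Matrix.add_mul, Matrix.mul_sub, Matrix.nonsing_inv_mul _ hdet]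
  simp

/-- The error `u - B (H u + e (a + C u) + ζ)` of the LMMSE filter has mean `k` when weighted with
the inverse of its covariance. The noise `e (a + C u) + ζ` is not Gaussian, and not independent of
`u`; only its being centred given `u`, with covariance `R` on average, enters. -/
theorem lintegral_lmmse_error (b : ℝ≥0) (a : Fin m → ℂ) (C H : Matrix (Fin m) (Fin k) ℂ) :
    ∫⁻ u, ∫⁻ e, ∫⁻ ζ,
      ENNReal.ofReal (star (u - lmmse (effCov b a C) H *ᵥ (H *ᵥ u + e • (a + C *ᵥ u) + ζ)) ⬝ᵥ
        ((1 + snrMatrix (effCov b a C) H) *ᵥ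
          (u - lmmse (effCov b a C) H *ᵥ (H *ᵥ u + e • (a + C *ᵥ u) + ζ)))).re
      ∂(stdCN m) ∂(scalarCN b) ∂(stdCN k) = k := by
  set R := effCov b a C with hR
  have hRd := posDef_effCov b a C
  set B := lmmse R H with hB
  set M := 1 + snrMatrix R H with hM
  have hMd : M.PosDef := posDef_one_add_snrMatrix hRd H
  have hdet : IsUnit M.det := (Matrix.isUnit_iff_isUnit_det _).1 hMd.isUnit
  obtain ⟨K, hK⟩ : ∃ K : Matrix (Fin k) (Fin k) ℂ, M = Kᴴ * K :=
    ⟨CFC.sqrt M, by rw [conjTranspose_sqrt, sqrt_mul_sqrt hMd.posSemidef]⟩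
  have e1 : ∀ x : Fin k → ℂ, (star x ⬝ᵥ (M *ᵥ x)).re = sqNorm (K *ᵥ x) := by
    intro x
    rw [sqNorm_eq_re, Matrix.star_mulVec, ← Matrix.dotProduct_mulVec, Matrix.mulVec_mulVec, hK]
  have e2 : ∀ (u : Fin k → ℂ) (e : ℂ) (ζ : Fin m → ℂ),
      K *ᵥ (u - B *ᵥ (H *ᵥ u + e • (a + C *ᵥ u) + ζ)) =
      ((K * (1 - B * H)) *ᵥ u + e • (-((K * B) *ᵥ a + (K * B * C) *ᵥ u))) + (-(K * B)) *ᵥ ζ := by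
    intro u e ζ
    simp only [Matrix.mulVec_add, Matrix.mulVec_sub, Matrix.mulVec_smul, Matrix.mul_sub,
      Matrix.mul_one, Matrix.sub_mulVec, Matrix.neg_mulVec, ← Matrix.mulVec_mulVec,
      Matrix.mul_assoc]
    module
  have hneg : ∀ x : Fin k → ℂ, sqNorm (-x) = sqNorm x := fun x => by simp [sqNorm]
  -- integrate out `ζ`, then `e`, then `u`; the three contributions add up to `tr (K M⁻¹ Kᴴ)`
  simp only [e1, e2, lintegral_sqNorm_stdCN]
  have hF : ∀ {p q : ℕ} (A : Matrix (Fin p) (Fin q) ℂ), frobSq (-A) = frobSq A := by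
    intro p q A; simp [frobSq_eq_trace]
  have e3 : ∀ u : Fin k → ℂ, ∫⁻ e, ENNReal.ofReal
      (sqNorm ((K * (1 - B * H)) *ᵥ u + e • (-((K * B) *ᵥ a + (K * B * C) *ᵥ u))) +
        frobSq (-(K * B))) ∂(scalarCN b) =
      ENNReal.ofReal (sqNorm (0 + (K * (1 - B * H)) *ᵥ u)) +
        ENNReal.ofReal b * ENNReal.ofReal (sqNorm ((K * B) *ᵥ a + (K * B * C) *ᵥ u)) +
        ENNReal.ofReal (frobSq (K * B)) := by
    intro u
    simp only [ENNReal.ofReal_add (sqNorm_nonneg _) (frobSq_nonneg _)]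
    rw [lintegral_add_right _ measurable_const, lintegral_sqNorm_scalarCN, lintegral_const,
      measure_univ, mul_one, hneg, hF, zero_add,
      ENNReal.ofReal_add (sqNorm_nonneg _) (mul_nonneg b.coe_nonneg (sqNorm_nonneg _)),
      ENNReal.ofReal_mul b.coe_nonneg]
  simp only [e3]
  have hm1 : ∀ (n p : ℕ) (x : Fin n → ℂ) (A : Matrix (Fin n) (Fin p) ℂ),
      Measurable fun u => ENNReal.ofReal (sqNorm (x + A *ᵥ u)) := fun n p x A =>
    (continuous_sqNorm.comp
      (by fun_prop : Continuous fun u => x + A *ᵥ u)).measurable.ennreal_ofReal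
  rw [lintegral_add_right _ measurable_const, lintegral_add_left (hm1 _ _ _ _),
    lintegral_const_mul _ (hm1 _ _ _ _), lintegral_sqNorm_stdCN, lintegral_sqNorm_stdCN,
    lintegral_const, measure_univ, mul_one, ← ENNReal.ofReal_mul b.coe_nonneg,
    ← ENNReal.ofReal_add (add_nonneg (sqNorm_nonneg _) (frobSq_nonneg _))
      (mul_nonneg b.coe_nonneg (add_nonneg (sqNorm_nonneg _) (frobSq_nonneg _))),
    ← ENNReal.ofReal_add _ (frobSq_nonneg _)]
  · rw [← ENNReal.ofReal_natCast]
    congr 1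
    have h0 : sqNorm (0 : Fin k → ℂ) = 0 := by simp [sqNorm]
    have h1 : sqNorm ((K * B) *ᵥ a) =
        (K * B * Matrix.vecMulVec a (star a) * (K * B)ᴴ).trace.re := by
      rw [Matrix.mul_vecMulVec, Matrix.vecMulVec_mul, ← Matrix.star_mulVec, Matrix.trace_vecMulVec,
        sqNorm_eq_re']
    have h2 : (K * (1 - B * H)) * (K * (1 - B * H))ᴴ +
        ((b : ℝ) : ℂ) • (K * B * Matrix.vecMulVec a (star a) * (K * B)ᴴ +
          (K * B * C) * (K * B * C)ᴴ) + (K * B) * (K * B)ᴴ = K * M⁻¹ * Kᴴ := by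
      rw [hM, ← lmmse_error hRd H, ← hB, ← hR]
      have : R = 1 + ((b : ℝ) : ℂ) • (Matrix.vecMulVec a (star a) + C * Cᴴ) := rfl
      rw [this]
      simp only [Matrix.conjTranspose_mul, Matrix.mul_add, Matrix.add_mul, Matrix.mul_smul,
        Matrix.smul_mul, Matrix.mul_one, Matrix.mul_assoc, smul_add]
      abel
    have h3 : (K * M⁻¹ * Kᴴ).trace = k := by
      rw [Matrix.trace_mul_comm, ← Matrix.mul_assoc, ← hK, Matrix.mul_nonsing_inv _ hdet,
        Matrix.trace_one, Fintype.card_fin]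
    have h4 := congrArg Complex.re (congrArg Matrix.trace h2)
    rw [h3, Matrix.trace_add, Matrix.trace_add, Matrix.trace_smul, Matrix.trace_add,
      Complex.add_re, Complex.add_re, smul_eq_mul, Complex.re_ofReal_mul, Complex.add_re,
      Complex.natCast_re] at h4
    rw [h0, h1, frobSq_eq_trace, frobSq_eq_trace, frobSq_eq_trace, zero_add]
    exact h4
  · have := sqNorm_nonneg (0 : Fin k → ℂ)
    have := frobSq_nonneg (K * (1 - B * H))
    have := mul_nonneg b.coe_nonneg (add_nonneg (sqNorm_nonneg ((K * B) *ᵥ a))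
      (frobSq_nonneg (K * B * C)))
    positivity

end Estimation

/-! ### Orthonormal bases and aligned precoders -/

theorem toLp_mulVec_mem_colSpace {N : ℕ} {ι : Type} [Fintype ι] [DecidableEq ι]
    (A : Matrix (Fin N) ι ℂ) (v : ι → ℂ) : WithLp.toLp 2 (A *ᵥ v) ∈ colSpace A :=
  ⟨WithLp.toLp 2 v, Matrix.toLpLin_toLp 2 2 A v⟩

theorem conjTranspose_mul_eq_zero {N k l : ℕ} {A : Matrix (Fin N) (Fin k) ℂ}
    {B : Matrix (Fin N) (Fin l) ℂ} {S : Submodule ℂ (EuclideanSpace ℂ (Fin N))}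
    (hA : ∀ v, WithLp.toLp 2 (A *ᵥ v) ∈ S) (hB : ∀ v, WithLp.toLp 2 (B *ᵥ v) ∈ Sᗮ) :
    Bᴴ * A = 0 := by
  ext i j
  have h := (Submodule.mem_orthogonal' _ _).1 (hB (Pi.single i 1)) _ (hA (Pi.single j 1))
  rw [EuclideanSpace.inner_toLp_toLp, Matrix.mulVec_single_one, Matrix.mulVec_single_one] at h
  rw [Matrix.zero_apply, ← h, dotProduct_comm]
  rfl

theorem exists_isOrthonormalBasisOf {N : ℕ} (S : Submodule ℂ (EuclideanSpace ℂ (Fin N))) :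
    ∃ U : Matrix (Fin N) (Fin (Module.finrank ℂ S)) ℂ, IsOrthonormalBasisOf U S := by
  set b := stdOrthonormalBasis ℂ S
  let U : Matrix (Fin N) (Fin (Module.finrank ℂ S)) ℂ :=
    Matrix.of fun i j => (b j : EuclideanSpace ℂ (Fin N)) i
  have hU : ∀ v : EuclideanSpace ℂ (Fin (Module.finrank ℂ S)), Matrix.toEuclideanLin U v =
      ((∑ j, v j • b j : S) : EuclideanSpace ℂ (Fin N)) := by
    intro v
    ext i
    simp [Matrix.toEuclideanLin, Matrix.mulVec, dotProduct, U, mul_comm]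
  refine ⟨U, ?_, ?_⟩
  · ext i j
    have h := orthonormal_iff_ite.1 b.orthonormal i j
    rw [Matrix.one_apply, ← h, Submodule.coe_inner, PiLp.inner_apply]
    simp [Matrix.mul_apply, U, mul_comm]
  · apply le_antisymm
    · rintro _ ⟨v, rfl⟩
      rw [hU]
      exact Submodule.coe_mem _
    · intro x hx
      refine ⟨WithLp.toLp 2 fun j => b.repr ⟨x, hx⟩ j, ?_⟩
      rw [hU]
      exact congrArg Subtype.val (b.sum_repr ⟨x, hx⟩)

/-- Some `u ≠ 0` has `Fᴴ u` and `Gᴴ u` on a common line: a kernel vector of `Gᴴ`, or else an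
eigenvector of `(Gᴴ)⁻¹ Fᴴ`. -/
theorem exists_conjTranspose_mulVec_parallel {N : ℕ} (hN : 1 ≤ N) (F G : Matrix (Fin N) (Fin N) ℂ) :
    ∃ u a : Fin N → ℂ, u ≠ 0 ∧ (∃ r : ℂ, Fᴴ *ᵥ u = r • a) ∧ ∃ r : ℂ, Gᴴ *ᵥ u = r • a := by
  have : Nonempty (Fin N) := ⟨⟨0, hN⟩⟩
  by_cases hG : Gᴴ.det = 0
  · obtain ⟨u, hu, h⟩ := Matrix.exists_mulVec_eq_zero_iff.2 hG
    exact ⟨u, Fᴴ *ᵥ u, hu, ⟨1, (one_smul _ _).symm⟩, 0, by rw [h, zero_smul]⟩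
  · obtain ⟨r, hr⟩ := Module.End.exists_eigenvalue (Matrix.toLin' ((Gᴴ)⁻¹ * Fᴴ))
    obtain ⟨u, hu⟩ := hr.exists_hasEigenvector
    refine ⟨u, Gᴴ *ᵥ u, hu.2, ⟨r, ?_⟩, 1, (one_smul _ _).symm⟩
    have h := hu.apply_eq_smul
    rw [Matrix.toLin'_apply] at h
    rw [← Matrix.mulVec_smul, ← h, Matrix.mulVec_mulVec,
      Matrix.mul_nonsing_inv_cancel_left _ _ (isUnit_iff_ne_zero.2 hG)]

theorem rank_le_of_conjTranspose_mulVec_eq_zero {N : ℕ} {ι : Type} [Fintype ι] [DecidableEq ι]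
    (A : Matrix (Fin N) ι ℂ) {u : Fin N → ℂ} (hu : u ≠ 0) (h : Aᴴ *ᵥ u = 0) :
    A.rank ≤ N - 1 := by
  rw [← Matrix.rank_conjTranspose, Matrix.rank]
  have h1 := LinearMap.finrank_range_add_finrank_ker Aᴴ.mulVecLin
  rw [Module.finrank_fin_fun] at h1
  have h2 : 0 < Module.finrank ℂ (LinearMap.ker Aᴴ.mulVecLin) := by
    rw [Module.finrank_pos_iff]
    exact ⟨⟨u, h⟩, 0, fun h' => hu (congrArg Subtype.val h')⟩
  omega

/-- If `Fᴴ u` and `Gᴴ u` are multiples of `a`, then any `N - 1` orthonormal columns orthogonal to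
`a` form an aligned precoder: the columns of `F V` and `G V` are orthogonal to `u`. -/
theorem alignedPrecoders_nonempty {N : ℕ} (hN : 1 ≤ N) (F G : Matrix (Fin N) (Fin N) ℂ) :
    (alignedPrecoders F G).Nonempty := by
  obtain ⟨u, a, hu, ⟨r₁, h₁⟩, r₂, h₂⟩ := exists_conjTranspose_mulVec_parallel hN F G
  set K : Submodule ℂ (EuclideanSpace ℂ (Fin N)) := (ℂ ∙ (WithLp.toLp 2 a))ᗮ with hK
  obtain ⟨U, hU, hUK⟩ := exists_isOrthonormalBasisOf K
  have hd : N - 1 ≤ Module.finrank ℂ K := by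
    have h1 : Module.finrank ℂ (ℂ ∙ (WithLp.toLp 2 a : EuclideanSpace ℂ (Fin N))) +
        Module.finrank ℂ K = N :=
      (Submodule.finrank_add_finrank_orthogonal _).trans finrank_euclideanSpace_fin
    have h2 := finrank_span_le_card (R := ℂ) ({WithLp.toLp 2 a} : Set (EuclideanSpace ℂ (Fin N)))
    rw [Set.toFinset_singleton, Finset.card_singleton] at h2
    exact Nat.sub_le_iff_le_add'.2 (h1.symm.le.trans (Nat.add_le_add_right h2 _))
  have hUa : Uᴴ *ᵥ a = 0 := by
    funext i
    have hmem : WithLp.toLp 2 (U *ᵥ Pi.single i 1) ∈ K :=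
      hUK.le (toLp_mulVec_mem_colSpace U _)
    have h := (Submodule.mem_orthogonal' _ _).1 hmem _ (Submodule.mem_span_singleton_self _)
    rw [EuclideanSpace.inner_toLp_toLp, Matrix.mulVec_single_one] at h
    rw [Pi.zero_apply, ← h, dotProduct_comm]
    rfl
  set V : Matrix (Fin N) (Fin (N - 1)) ℂ := U.submatrix id (Fin.castLE hd) with hV
  have hVa : Vᴴ *ᵥ a = 0 := by
    funext i
    exact congrFun hUa (Fin.castLE hd i)
  refine ⟨V, ?_, ?_⟩
  · have : Vᴴ * V = (Uᴴ * U).submatrix (Fin.castLE hd) (Fin.castLE hd) := rfl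
    rw [this, hU, Matrix.submatrix_one _ (Fin.castLE_injective hd)]
  · apply rank_le_of_conjTranspose_mulVec_eq_zero _ hu
    rw [Matrix.conjTranspose_fromCols_eq_fromRows_conjTranspose, Matrix.fromRows_mulVec,
      Matrix.conjTranspose_mul, Matrix.conjTranspose_mul, ← Matrix.mulVec_mulVec,
      ← Matrix.mulVec_mulVec, h₁, h₂, Matrix.mulVec_smul, Matrix.mulVec_smul, hVa, smul_zero,
      smul_zero]
    funext i
    cases i <;> rfl

theorem exists_feasible {N : ℕ} (hN : 1 ≤ N) (F G : Matrix (Fin N) (Fin N) ℂ) {P : ℝ}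
    (hP : 0 ≤ P) : ∃ c : Scheme N, c.Feasible F G P := by
  obtain ⟨V, hV⟩ := alignedPrecoders_nonempty hN F G
  obtain ⟨U, hU⟩ := exists_isOrthonormalBasisOf (alignSubspace F G V)
  obtain ⟨U', hU'⟩ := exists_isOrthonormalBasisOf (alignSubspace F G V)ᗮ
  refine ⟨⟨Measure.dirac 0, V, Pi.single ⟨0, hN⟩ 1, 0, _, _, U, U'⟩, ?_⟩
  exact
    { isProbabilityMeasure := Measure.dirac.isProbabilityMeasure
      aligned := hV
      unit := by simp [sqNorm, Pi.single_apply, apply_ite]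
      posSemidef := Matrix.PosSemidef.zero
      refinedPower := by simpa using hP
      coarsePower := by simp
      basis := hU
      basisPerp := hU' }

namespace Scheme.Feasible

variable {N : ℕ} {c : Scheme N} {F G : Matrix (Fin N) (Fin N) ℂ} {P : ℝ}

/-- Alignment: the refined layer does not reach the projection onto `𝒮ᗮ`. -/
theorem uperp_mul_precoded (h : c.Feasible F G P) :
    c.Uperpᴴ * (F * c.V) = 0 ∧ c.Uperpᴴ * (G * c.V) = 0 := by
  have hB : ∀ v, WithLp.toLp 2 (c.Uperp *ᵥ v) ∈ (alignSubspace F G c.V)ᗮ := fun v =>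
    h.basisPerp.2.le (toLp_mulVec_mem_colSpace c.Uperp v)
  constructor
  · refine conjTranspose_mul_eq_zero (S := alignSubspace F G c.V) (fun v => ?_) hB
    have := toLp_mulVec_mem_colSpace (Matrix.fromCols (F * c.V) (G * c.V)) (Sum.elim v 0)
    rwa [Matrix.fromCols_mulVec_sumElim, Matrix.mulVec_zero, add_zero] at this
  · refine conjTranspose_mul_eq_zero (S := alignSubspace F G c.V) (fun v => ?_) hB
    have := toLp_mulVec_mem_colSpace (Matrix.fromCols (F * c.V) (G * c.V)) (Sum.elim 0 v)
    rwa [Matrix.fromCols_mulVec_sumElim, Matrix.mulVec_zero, zero_add] at this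

theorem u_mul_uperp (h : c.Feasible F G P) : c.Uᴴ * c.Uperp = 0 := by
  have h1 : c.Uperpᴴ * c.U = 0 :=
    conjTranspose_mul_eq_zero (S := alignSubspace F G c.V)
      (fun v => h.basis.2.le (toLp_mulVec_mem_colSpace c.U v))
      (fun v => h.basisPerp.2.le (toLp_mulVec_mem_colSpace c.Uperp v))
  have h2 := congrArg Matrix.conjTranspose h1
  simpa using h2

end Scheme.Feasible

namespace Scheme

variable {N : ℕ} (c : Scheme N) (F G : Matrix (Fin N) (Fin N) ℂ) (σ : ℝ≥0)

/-! ### The refined layer as a linear Gaussian model -/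

/-- The fraction `1 / (1 + σ² ‖g_⊥‖²)` of the power of `s` that remains as estimation error. -/
def errFrac (w : ℂ) : ℝ≥0 := 1 / (1 + σ ^ 2 * (sqNorm (c.gPerp G w)).toNNReal)

/-- The complementary fraction `σ² ‖g_⊥‖² / (1 + σ² ‖g_⊥‖²)`, which is the gain of `ŝ` on `s`. -/
def estFrac (w : ℂ) : ℝ≥0 :=
  σ ^ 2 * (sqNorm (c.gPerp G w)).toNNReal / (1 + σ ^ 2 * (sqNorm (c.gPerp G w)).toNNReal)

theorem estFrac_add_errFrac (w : ℂ) : c.estFrac G σ w + c.errFrac G σ w = 1 := by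
  rw [estFrac, errFrac, ← add_div, add_comm]
  exact div_self (by positivity)

theorem coe_errFrac (w : ℂ) : ((σ ^ 2 * c.errFrac G σ w : ℝ≥0) : ℝ) = c.errVar G σ w := by
  rw [errFrac, errVar]
  push_cast
  rw [Real.coe_toNNReal _ (sqNorm_nonneg _)]
  ring

theorem coe_estFrac (w : ℂ) :
    (c.estFrac G σ w : ℝ) = c.errVar G σ w * sqNorm (c.gPerp G w) := by
  rw [estFrac, errVar]
  push_cast
  rw [Real.coe_toNNReal _ (sqNorm_nonneg _)]
  ring

/-- The coefficients of the noise `z` in `ŝ`. -/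
def noiseFunctional (w : ℂ) : Fin N → ℂ :=
  (c.errVar G σ w : ℂ) • (star (c.gPerp G w) ᵥ* c.Uperpᴴ)

/-- The channel `H(t) = Uᴴ (F + t G) V Q_d^{1/2}` that the white symbol `u`, with `w_d = Q_d^{1/2}
u`, sees on `𝒮` when `ŝ = t`. -/
def effChannel (t : ℂ) : Matrix (Fin c.dimS) (Fin (N - 1)) ℂ :=
  c.Uᴴ * (F + t • G) * c.V * CFC.sqrt c.Qd

/-- The output on `𝒮` after the coarse signal, at the channel estimate `F + ŝ G`, has been removed.
-/
def residual (w : ℂ) (y : Fin N → ℂ) : Fin c.dimS → ℂ :=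
  c.Uᴴ *ᵥ (y - F *ᵥ c.xp w - c.sHat F G σ w y • (G *ᵥ c.xp w))

variable {c F G σ} {P : ℝ}

theorem noiseCov_eq (hQ : c.Qd.PosSemidef) (w : ℂ) :
    c.noiseCov G σ w = effCov (σ ^ 2 * c.errFrac G σ w) (c.Uᴴ *ᵥ (G *ᵥ c.xp w))
      (c.Uᴴ * G * c.V * CFC.sqrt c.Qd) := by
  rw [noiseCov, effCov, coe_errFrac]
  congr 1
  rw [Matrix.mul_smul, Matrix.smul_mul]
  congr 1
  have h1 : Matrix.vecMulVec (c.Uᴴ *ᵥ (G *ᵥ c.xp w)) (star (c.Uᴴ *ᵥ (G *ᵥ c.xp w))) =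
      c.Uᴴ * (G * Matrix.vecMulVec (c.xp w) (star (c.xp w)) * Gᴴ) * c.U := by
    simp only [Matrix.mul_vecMulVec, Matrix.vecMulVec_mul, Matrix.star_mulVec,
      Matrix.conjTranspose_conjTranspose]
  have h2 : c.Uᴴ * G * c.V * CFC.sqrt c.Qd * (c.Uᴴ * G * c.V * CFC.sqrt c.Qd)ᴴ =
      c.Uᴴ * (G * (c.V * c.Qd * c.Vᴴ) * Gᴴ) * c.U := by
    conv_rhs => rw [← sqrt_mul_sqrt hQ]
    simp only [Matrix.conjTranspose_mul, Matrix.conjTranspose_conjTranspose, conjTranspose_sqrt,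
      Matrix.mul_assoc]
  rw [h1, h2]
  simp only [Matrix.mul_add, Matrix.add_mul]

theorem posDef_noiseCov (hQ : c.Qd.PosSemidef) (w : ℂ) : (c.noiseCov G σ w).PosDef := by
  rw [noiseCov_eq hQ]
  exact posDef_effCov _ _ _

/-- The determinant of the refined rate in the symmetric form `det (I + Hᴴ R⁻¹ H)`, by Sylvester's
identity. -/
theorem logDet_eq (hQ : c.Qd.PosSemidef) (w t : ℂ) :
    c.logDet F G σ w t =
      Real.log (1 + snrMatrix (c.noiseCov G σ w) (c.effChannel F G t)).det.re := by
  rw [logDet]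
  congr 2
  conv_lhs => rw [← sqrt_mul_sqrt hQ]
  rw [Matrix.mul_assoc, Matrix.det_one_add_mul_comm]
  congr 2
  simp only [snrMatrix, effChannel, Matrix.conjTranspose_mul, Matrix.conjTranspose_conjTranspose,
    conjTranspose_sqrt, Matrix.mul_assoc]

theorem logDet_nonneg (hQ : c.Qd.PosSemidef) (w t : ℂ) : 0 ≤ c.logDet F G σ w t := by
  rw [logDet_eq hQ]
  exact Real.log_nonneg (one_le_det_one_add (posSemidef_snrMatrix (posDef_noiseCov hQ w) _))

theorem exp_logDet (hQ : c.Qd.PosSemidef) (w t : ℂ) :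
    Real.exp (c.logDet F G σ w t) =
      (1 + snrMatrix (c.noiseCov G σ w) (c.effChannel F G t)).det.re := by
  rw [logDet_eq hQ, Real.exp_log]
  exact zero_lt_one.trans_le
    (one_le_det_one_add (posSemidef_snrMatrix (posDef_noiseCov hQ w) _))

theorem logDet_le (hQ : c.Qd.PosSemidef) (w t : ℂ) :
    c.logDet F G σ w t ≤ frobSq (c.effChannel F G t) := by
  rw [logDet_eq hQ]
  refine (log_det_one_add_le (posSemidef_snrMatrix (posDef_noiseCov hQ w) _)).trans ?_
  rw [noiseCov_eq hQ]
  exact trace_snrMatrix_le _ _ _ _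

theorem uperp_output (h : c.Feasible F G P) (w : ℂ) (wd : Fin (N - 1) → ℂ) (s : ℂ)
    (z : Fin N → ℂ) :
    c.Uperpᴴ *ᵥ output F G s (c.input w wd) z =
      c.Uperpᴴ *ᵥ (F *ᵥ c.xp w) + s • c.gPerp G w + c.Uperpᴴ *ᵥ z := by
  obtain ⟨h1, h2⟩ := h.uperp_mul_precoded
  have h3 : c.Uperpᴴ *ᵥ (F *ᵥ (c.V *ᵥ wd)) = 0 := by
    rw [Matrix.mulVec_mulVec, Matrix.mulVec_mulVec, Matrix.mul_assoc, h1, Matrix.zero_mulVec]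
  have h4 : c.Uperpᴴ *ᵥ (G *ᵥ (c.V *ᵥ wd)) = 0 := by
    rw [Matrix.mulVec_mulVec, Matrix.mulVec_mulVec, Matrix.mul_assoc, h2, Matrix.zero_mulVec]
  simp only [output, input, gPerp, Matrix.mulVec_add, Matrix.add_mulVec, Matrix.smul_mulVec,
    Matrix.mulVec_smul, h3, h4, smul_zero, add_zero]

theorem sHat_output (h : c.Feasible F G P) (w : ℂ) (wd : Fin (N - 1) → ℂ) (s : ℂ)
    (z : Fin N → ℂ) :
    c.sHat F G σ w (output F G s (c.input w wd) z) =
      ((c.estFrac G σ w : ℝ) : ℂ) * s + c.noiseFunctional G σ w ⬝ᵥ z := by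
  rw [sHat, Matrix.mulVec_sub, uperp_output h, coe_estFrac, noiseFunctional, smul_dotProduct,
    ← Matrix.dotProduct_mulVec]
  have : c.Uperpᴴ *ᵥ (F *ᵥ c.xp w) + s • c.gPerp G w + c.Uperpᴴ *ᵥ z -
      c.Uperpᴴ *ᵥ (F *ᵥ c.xp w) = s • c.gPerp G w + c.Uperpᴴ *ᵥ z := by abel
  rw [this, dotProduct_add, dotProduct_smul, ← sqNorm_eq_dotProduct]
  push_cast
  simp only [smul_eq_mul]
  ring

/-- The residual as the output of a linear model for `u`, with channel `H(ŝ)` and the channel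
estimation error `s - ŝ` multiplying both the coarse and the refined signal. -/
theorem residual_output (h : c.Feasible F G P) (w : ℂ) (u : Fin (N - 1) → ℂ) (s : ℂ)
    (z : Fin N → ℂ) :
    c.residual F G σ w (output F G s (c.input w (CFC.sqrt c.Qd *ᵥ u)) z) =
      c.effChannel F G (((c.estFrac G σ w : ℝ) : ℂ) * s + c.noiseFunctional G σ w ⬝ᵥ z) *ᵥ u +
      (((c.errFrac G σ w : ℝ) : ℂ) * s - c.noiseFunctional G σ w ⬝ᵥ z) •
        (c.Uᴴ *ᵥ (G *ᵥ c.xp w) + (c.Uᴴ * G * c.V * CFC.sqrt c.Qd) *ᵥ u) + c.Uᴴ *ᵥ z := by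
  have hs : ((c.errFrac G σ w : ℝ) : ℂ) * s - c.noiseFunctional G σ w ⬝ᵥ z =
      s - (((c.estFrac G σ w : ℝ) : ℂ) * s + c.noiseFunctional G σ w ⬝ᵥ z) := by
    have h1 := congrArg (fun x : ℝ≥0 => ((x : ℝ) : ℂ)) (c.estFrac_add_errFrac G σ w)
    push_cast at h1
    linear_combination s * h1
  rw [residual, sHat_output h, hs]
  set t := ((c.estFrac G σ w : ℝ) : ℂ) * s + c.noiseFunctional G σ w ⬝ᵥ z
  simp only [output, input, effChannel, Matrix.mulVec_add, Matrix.add_mulVec, Matrix.smul_mulVec,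
    Matrix.mulVec_smul, Matrix.mulVec_sub, Matrix.mul_add, Matrix.add_mul, Matrix.mul_smul,
    Matrix.smul_mul, ← Matrix.mulVec_mulVec, Matrix.mul_assoc]
  module

/-- Given `w_p`, the estimate `ŝ`, its error `s - ŝ` and the noise `Uᴴ z` on `𝒮` are independent
complex Gaussians. -/
theorem map_sHat_error_noise (h : c.Feasible F G P) (w : ℂ) :
    ((scalarCN (σ ^ 2)).prod (stdCN N)).map
        (fun p => (((c.estFrac G σ w : ℝ) : ℂ) * p.1 + c.noiseFunctional G σ w ⬝ᵥ p.2,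
          ((c.errFrac G σ w : ℝ) : ℂ) * p.1 - c.noiseFunctional G σ w ⬝ᵥ p.2, c.Uᴴ *ᵥ p.2)) =
      (scalarCN (σ ^ 2 * c.estFrac G σ w)).prod
        ((scalarCN (σ ^ 2 * c.errFrac G σ w)).prod (stdCN c.dimS)) := by
  have hst : star (c.noiseFunctional G σ w) =
      (c.errVar G σ w : ℂ) • (c.Uperp *ᵥ c.gPerp G w) := by
    rw [noiseFunctional, star_smul, Matrix.star_vecMul, star_star,
      Matrix.conjTranspose_conjTranspose]
    simp
  refine map_estimate_error_noise _ _ _ (c.estFrac_add_errFrac G σ w) h.basis.1 ?_ ?_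
  · rw [hst, Matrix.mulVec_smul, Matrix.mulVec_mulVec, h.u_mul_uperp, Matrix.zero_mulVec,
      smul_zero]
  · have h1 : ((σ ^ 2 : ℝ≥0) : ℝ) * c.estFrac G σ w * c.errFrac G σ w =
        c.errVar G σ w * c.estFrac G σ w := by
      rw [← coe_errFrac]; push_cast; ring
    have h2 : sqNorm (c.Uperp *ᵥ c.gPerp G w) = sqNorm (c.gPerp G w) := by
      rw [sqNorm_eq_re, sqNorm_eq_re, Matrix.star_mulVec, ← Matrix.dotProduct_mulVec,
        Matrix.mulVec_mulVec, h.basisPerp.1, Matrix.one_mulVec]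
    rw [h1, coe_estFrac, ← sqNorm_star (c.noiseFunctional G σ w), hst,
      sqNorm_smul, h2, Complex.norm_real, Real.norm_eq_abs, sq_abs]
    ring

/-! ### Continuity -/

variable (c F G σ)

theorem continuous_xp : Continuous c.xp := by
  unfold xp; fun_prop

theorem continuous_errVar : Continuous (c.errVar G σ) := by
  unfold errVar gPerp
  have h1 := continuous_sqNorm (n := c.dimPerp)
  have h2 := c.continuous_xp
  refine Continuous.div (by fun_prop) (by fun_prop) fun w => ?_
  have := sqNorm_nonneg (c.Uperpᴴ *ᵥ (G *ᵥ c.xp w))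
  positivity

theorem continuous_noiseCov : Continuous (c.noiseCov G σ) := by
  unfold noiseCov
  have h1 := c.continuous_errVar G σ
  have h2 := c.continuous_xp
  have h3 : Continuous fun w => Matrix.vecMulVec (c.xp w) (star (c.xp w)) :=
    h2.matrix_vecMulVec h2.star
  fun_prop

theorem continuous_effChannel : Continuous (c.effChannel F G) := by
  unfold effChannel; fun_prop

theorem continuous_sHat : Continuous fun p : ℂ × (Fin N → ℂ) => c.sHat F G σ p.1 p.2 := by
  unfold sHat gPerp dotProduct
  have h1 := c.continuous_errVar G σ
  have h2 := c.continuous_xp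
  fun_prop

theorem continuous_residual :
    Continuous fun p : ℂ × (Fin N → ℂ) => c.residual F G σ p.1 p.2 := by
  unfold residual
  have h1 := c.continuous_sHat F G σ
  have h2 := c.continuous_xp
  fun_prop

theorem continuous_snrMatrix (hQ : c.Qd.PosSemidef) : Continuous fun p : ℂ × ℂ =>
    snrMatrix (c.noiseCov G σ p.1) (c.effChannel F G p.2) := by
  have h1 := continuous_matrix_inv (c.continuous_noiseCov G σ)
    fun w => posDef_noiseCov hQ w
  have h2 := c.continuous_effChannel F G
  unfold snrMatrix
  have h3 : Continuous fun p : ℂ × ℂ => (c.effChannel F G p.2)ᴴ :=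
    (h2.comp continuous_snd).matrix_conjTranspose
  exact (h3.matrix_mul (h1.comp continuous_fst)).matrix_mul (h2.comp continuous_snd)

theorem continuous_lmmse (hQ : c.Qd.PosSemidef) : Continuous fun p : ℂ × ℂ =>
    lmmse (c.noiseCov G σ p.1) (c.effChannel F G p.2) := by
  have h1 := continuous_matrix_inv (c.continuous_noiseCov G σ)
    fun w => posDef_noiseCov hQ w
  have h2 := c.continuous_effChannel F G
  unfold lmmse
  have h3 : Continuous fun p : ℂ × ℂ => (c.effChannel F G p.2)ᴴ :=
    (h2.comp continuous_snd).matrix_conjTranspose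
  have h4 := continuous_matrix_inv (continuous_const.add (c.continuous_snrMatrix F G σ hQ))
    fun p : ℂ × ℂ => posDef_one_add_snrMatrix (posDef_noiseCov hQ p.1) _
  exact h4.matrix_mul (h3.matrix_mul (h1.comp continuous_fst))

theorem continuous_logDet (hQ : c.Qd.PosSemidef) :
    Continuous fun p : ℂ × ℂ => c.logDet F G σ p.1 p.2 := by
  simp only [logDet_eq hQ]
  have h := c.continuous_snrMatrix F G σ hQ
  refine Continuous.log (Complex.continuous_re.comp (continuous_const.add h).matrix_det)
    fun p => ?_
  exact (zero_lt_one.trans_le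
    (one_le_det_one_add (posSemidef_snrMatrix (posDef_noiseCov hQ p.1) _))).ne'

/-! ### The refined decoding metric -/

/-- The joint law of `(w_p, u, s, z)`, where `u ∼ CN(0, I)` and `w_d = Q_d^{1/2} u`. Passing to `u`
allows for a singular `Q_d`. -/
def latentLaw : Measure (ℂ × (Fin (N - 1) → ℂ) × ℂ × (Fin N → ℂ)) :=
  c.coarseLaw.prod ((stdCN (N - 1)).prod ((scalarCN (σ ^ 2)).prod (stdCN N)))

/-- The squared error of the LMMSE estimate of `u` from `r`, given `w_p = w` and `ŝ = t`, weighted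
with the inverse `I + Hᴴ R⁻¹ H` of the error covariance. -/
def errForm (w t : ℂ) (u : Fin (N - 1) → ℂ) (r : Fin c.dimS → ℂ) : ℝ :=
  (star (u - lmmse (c.noiseCov G σ w) (c.effChannel F G t) *ᵥ r) ⬝ᵥ
    ((1 + snrMatrix (c.noiseCov G σ w) (c.effChannel F G t)) *ᵥ
      (u - lmmse (c.noiseCov G σ w) (c.effChannel F G t) *ᵥ r))).re

/-- The logarithm of the decoding metric of the refined layer: the density of the Gaussian law with
the LMMSE mean and error covariance relative to `CN(0, I)`, evaluated at `u`. -/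
def score (w : ℂ) (u : Fin (N - 1) → ℂ) (y : Fin N → ℂ) : ℝ :=
  c.logDet F G σ w (c.sHat F G σ w y) +
    (sqNorm u - c.errForm F G σ w (c.sHat F G σ w y) u (c.residual F G σ w y))

/-- The channel output as a function of `(w_p, u, s, z)`. -/
def latentOutput (ω : ℂ × (Fin (N - 1) → ℂ) × ℂ × (Fin N → ℂ)) : Fin N → ℂ :=
  output F G ω.2.2.1 (c.input ω.1 (CFC.sqrt c.Qd *ᵥ ω.2.1)) ω.2.2.2

theorem continuous_errForm (hQ : c.Qd.PosSemidef) :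
    Continuous fun p : (ℂ × ℂ) × (Fin (N - 1) → ℂ) × (Fin c.dimS → ℂ) =>
      c.errForm F G σ p.1.1 p.1.2 p.2.1 p.2.2 := by
  have h1 := (c.continuous_lmmse F G σ hQ).comp
    (continuous_fst (X := ℂ × ℂ) (Y := (Fin (N - 1) → ℂ) × (Fin c.dimS → ℂ)))
  have h2 := (c.continuous_snrMatrix F G σ hQ).comp
    (continuous_fst (X := ℂ × ℂ) (Y := (Fin (N - 1) → ℂ) × (Fin c.dimS → ℂ)))
  have h3 : Continuous fun p : (ℂ × ℂ) × (Fin (N - 1) → ℂ) × (Fin c.dimS → ℂ) =>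
      p.2.1 - lmmse (c.noiseCov G σ p.1.1) (c.effChannel F G p.1.2) *ᵥ p.2.2 :=
    continuous_snd.fst.sub (h1.matrix_mulVec continuous_snd.snd)
  exact Complex.continuous_re.comp
    (h3.star.dotProduct ((continuous_const.add h2).matrix_mulVec h3))

theorem continuous_score (hQ : c.Qd.PosSemidef) :
    Continuous fun p : ℂ × (Fin (N - 1) → ℂ) × (Fin N → ℂ) =>
      c.score F G σ p.1 p.2.1 p.2.2 := by
  have hwy : Continuous fun p : ℂ × (Fin (N - 1) → ℂ) × (Fin N → ℂ) => (p.1, p.2.2) := by fun_prop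
  have h1 := (c.continuous_sHat F G σ).comp hwy
  have h2 := (c.continuous_residual F G σ).comp hwy
  have h3 := (c.continuous_logDet F G σ hQ).comp (continuous_fst.prodMk h1)
  have h4 := (c.continuous_errForm F G σ hQ).comp ((continuous_fst.prodMk h1).prodMk
    (continuous_snd.fst.prodMk h2))
  exact h3.add ((continuous_sqNorm.comp continuous_snd.fst).sub h4)

variable {c F G σ} in
theorem errForm_nonneg (hQ : c.Qd.PosSemidef) (w t : ℂ) (u : Fin (N - 1) → ℂ)
    (r : Fin c.dimS → ℂ) : 0 ≤ c.errForm F G σ w t u r :=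
  (posDef_one_add_snrMatrix (posDef_noiseCov hQ w) _).posSemidef.re_dotProduct_nonneg _

theorem continuous_latentOutput : Continuous (c.latentOutput F G) := by
  have := c.continuous_xp
  unfold latentOutput output input; fun_prop

variable {c F G σ}

theorem map_latentLaw (h : c.Feasible F G P) :
    (c.latentLaw σ).map (fun ω => (ω.1, CFC.sqrt c.Qd *ᵥ ω.2.1, ω.2.2)) = c.law σ := by
  have := h.isProbabilityMeasure
  have hm : Measurable fun u : Fin (N - 1) → ℂ => CFC.sqrt c.Qd *ᵥ u :=
    Continuous.measurable (by fun_prop)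
  rw [latentLaw, law, vectorCN]
  have h1 := Measure.map_prod_map (stdCN (N - 1)) ((scalarCN (σ ^ 2)).prod (stdCN N)) hm
    measurable_id
  have h2 := Measure.map_prod_map c.coarseLaw
    ((stdCN (N - 1)).prod ((scalarCN (σ ^ 2)).prod (stdCN N))) measurable_id
    (hm.prodMap (measurable_id (α := ℂ × (Fin N → ℂ))))
  rw [Measure.map_id] at h1 h2
  rw [h1, h2]
  rfl

/-- An average over `(s, z)` of a function of `ŝ`, `s - ŝ` and `Uᴴ z` is an average over independent
Gaussians. -/
theorem lintegral_estimate (h : c.Feasible F G P) (w : ℂ) {f : ℂ → ℂ → (Fin c.dimS → ℂ) → ℝ≥0∞}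
    (hf : Measurable fun p : ℂ × ℂ × (Fin c.dimS → ℂ) => f p.1 p.2.1 p.2.2) :
    ∫⁻ p, f (((c.estFrac G σ w : ℝ) : ℂ) * p.1 + c.noiseFunctional G σ w ⬝ᵥ p.2)
        (((c.errFrac G σ w : ℝ) : ℂ) * p.1 - c.noiseFunctional G σ w ⬝ᵥ p.2) (c.Uᴴ *ᵥ p.2)
        ∂((scalarCN (σ ^ 2)).prod (stdCN N)) =
      ∫⁻ t, ∫⁻ e, ∫⁻ ζ, f t e ζ ∂(stdCN c.dimS) ∂(scalarCN (σ ^ 2 * c.errFrac G σ w))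
        ∂(scalarCN (σ ^ 2 * c.estFrac G σ w)) := by
  have hm : Measurable fun p : ℂ × (Fin N → ℂ) =>
      (((c.estFrac G σ w : ℝ) : ℂ) * p.1 + c.noiseFunctional G σ w ⬝ᵥ p.2,
          ((c.errFrac G σ w : ℝ) : ℂ) * p.1 - c.noiseFunctional G σ w ⬝ᵥ p.2, c.Uᴴ *ᵥ p.2) :=
    Continuous.measurable (by unfold dotProduct; fun_prop)
  have h1 := lintegral_map (μ := (scalarCN (σ ^ 2)).prod (stdCN N)) hf hm
  rw [map_sHat_error_noise h] at h1
  rw [← h1, lintegral_prod _ hf.aemeasurable]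
  refine lintegral_congr fun t => ?_
  exact lintegral_prod _ (hf.comp measurable_prodMk_left).aemeasurable

theorem measurable_latent_logDet (hQ : c.Qd.PosSemidef) :
    Measurable fun ω => c.logDet F G σ ω.1 (c.sHat F G σ ω.1 (c.latentOutput F G ω)) :=
  have hwy : Continuous fun ω => (ω.1, c.latentOutput F G ω) :=
    continuous_fst.prodMk (c.continuous_latentOutput F G)
  have ht := (c.continuous_sHat F G σ).comp hwy
  ((c.continuous_logDet F G σ hQ).comp (continuous_fst.prodMk ht)).measurable

/-- The second moment of `H(t)` under `t ∼ CN(0, b)`, which dominates the mean of the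
log-determinant. -/
theorem lintegral_frobSq_effChannel (b : ℝ≥0) :
    ∫⁻ t, ENNReal.ofReal (frobSq (c.effChannel F G t)) ∂(scalarCN b) =
      ENNReal.ofReal (frobSq (c.effChannel F G 0) +
        b * frobSq (c.Uᴴ * G * c.V * CFC.sqrt c.Qd)) := by
  have e : ∀ t i, (c.effChannel F G t).row i =
      (c.effChannel F G 0).row i + t • (c.Uᴴ * G * c.V * CFC.sqrt c.Qd).row i := by
    intro t i
    have : c.effChannel F G t =
        c.effChannel F G 0 + t • (c.Uᴴ * G * c.V * CFC.sqrt c.Qd) := by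
      simp [effChannel, Matrix.mul_add, Matrix.add_mul]
    rw [this]
    rfl
  have hm : ∀ i, Measurable fun t => ENNReal.ofReal (sqNorm ((c.effChannel F G 0).row i +
      t • (c.Uᴴ * G * c.V * CFC.sqrt c.Qd).row i)) := fun i =>
    (continuous_sqNorm.comp (by fun_prop : Continuous fun t : ℂ => (c.effChannel F G 0).row i +
      t • (c.Uᴴ * G * c.V * CFC.sqrt c.Qd).row i)).measurable.ennreal_ofReal
  have e' : ∀ t, ENNReal.ofReal (frobSq (c.effChannel F G t)) =
      ∑ i, ENNReal.ofReal (sqNorm ((c.effChannel F G 0).row i +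
        t • (c.Uᴴ * G * c.V * CFC.sqrt c.Qd).row i)) := by
    intro t
    rw [frobSq, ENNReal.ofReal_sum_of_nonneg fun _ _ => sqNorm_nonneg _]
    exact Finset.sum_congr rfl fun i _ => by rw [e]
  simp only [e']
  rw [lintegral_finsetSum _ fun i _ => hm i]
  simp only [lintegral_sqNorm_scalarCN]
  rw [← ENNReal.ofReal_sum_of_nonneg fun i _ => add_nonneg (sqNorm_nonneg _)
    (mul_nonneg b.coe_nonneg (sqNorm_nonneg _)), Finset.sum_add_distrib, ← Finset.mul_sum]
  rfl

theorem integrable_latent_logDet (h : c.Feasible F G P) :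
    Integrable (fun ω => c.logDet F G σ ω.1 (c.sHat F G σ ω.1 (c.latentOutput F G ω)))
      (c.latentLaw σ) := by
  have := h.isProbabilityMeasure
  have hQ := h.posSemidef
  have hm := measurable_latent_logDet (c := c) (F := F) (G := G) (σ := σ) hQ
  refine ⟨hm.aestronglyMeasurable, ?_⟩
  rw [hasFiniteIntegral_iff_ofReal (ae_of_all _ fun ω => logDet_nonneg hQ _ _)]
  have hF : Continuous fun t => frobSq (c.effChannel F G t) := by
    have := c.continuous_effChannel F G
    simp only [frobSq_eq_trace]
    exact Complex.continuous_re.comp (this.matrix_mul this.matrix_conjTranspose).matrix_trace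
  -- given `w_p`, the estimate `ŝ` has variance at most `σ²`, so `D` bounds the mean of `‖H(ŝ)‖²`
  set D := frobSq (c.effChannel F G 0) +
    (σ : ℝ) ^ 2 * frobSq (c.Uᴴ * G * c.V * CFC.sqrt c.Qd) with hD
  have hbound : ∀ w u, ∫⁻ p : ℂ × (Fin N → ℂ), ENNReal.ofReal (c.logDet F G σ w
      (c.sHat F G σ w (c.latentOutput F G (w, u, p)))) ∂((scalarCN (σ ^ 2)).prod (stdCN N)) ≤
      ENNReal.ofReal D := by
    intro w u
    calc _ ≤ ∫⁻ p : ℂ × (Fin N → ℂ), ENNReal.ofReal (frobSq (c.effChannel F G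
            (((c.estFrac G σ w : ℝ) : ℂ) * p.1 + c.noiseFunctional G σ w ⬝ᵥ p.2)))
            ∂((scalarCN (σ ^ 2)).prod (stdCN N)) := by
          refine lintegral_mono fun p => ENNReal.ofReal_le_ofReal ?_
          rw [← sHat_output h w (CFC.sqrt c.Qd *ᵥ u)]
          exact logDet_le hQ _ _
      _ = ∫⁻ t, ENNReal.ofReal (frobSq (c.effChannel F G t))
            ∂(scalarCN (σ ^ 2 * c.estFrac G σ w)) := by
          rw [lintegral_estimate h w (f := fun t _ _ =>
            ENNReal.ofReal (frobSq (c.effChannel F G t)))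
            ((hF.measurable.comp measurable_fst).ennreal_ofReal)]
          simp
      _ ≤ ENNReal.ofReal D := by
          rw [lintegral_frobSq_effChannel]
          refine ENNReal.ofReal_le_ofReal (add_le_add_right ?_ _)
          refine mul_le_mul_of_nonneg_right ?_ (frobSq_nonneg _)
          have h1 : c.estFrac G σ w ≤ 1 := by
            rw [← c.estFrac_add_errFrac G σ w]; exact le_self_add
          have h2 : ((σ ^ 2 * c.estFrac G σ w : ℝ≥0) : ℝ) ≤ ((σ ^ 2 * 1 : ℝ≥0) : ℝ) := by gcongr
          simpa using h2
  rw [latentLaw, lintegral_prod _ hm.ennreal_ofReal.aemeasurable]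
  refine lt_of_le_of_lt (b := ENNReal.ofReal D) ?_ ENNReal.ofReal_lt_top
  calc _ = ∫⁻ w, ∫⁻ u, ∫⁻ p : ℂ × (Fin N → ℂ), ENNReal.ofReal (c.logDet F G σ w
      (c.sHat F G σ w (c.latentOutput F G (w, u, p)))) ∂((scalarCN (σ ^ 2)).prod (stdCN N))
        ∂(stdCN (N - 1)) ∂c.coarseLaw := by
        refine lintegral_congr fun w => ?_
        exact lintegral_prod _ (hm.ennreal_ofReal.comp measurable_prodMk_left).aemeasurable
    _ ≤ ∫⁻ w, ∫⁻ u, ENNReal.ofReal D ∂(stdCN (N - 1)) ∂c.coarseLaw :=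
        lintegral_mono fun w => lintegral_mono fun u => hbound w u
    _ = ENNReal.ofReal D := by simp

/-- The random variable of the refined rate is integrable, and its mean can be computed in the
latent variables. -/
theorem integrable_refinedLogDet_and_refinedRate_eq (h : c.Feasible F G P) :
    Integrable (c.refinedLogDet F G σ) (c.law σ) ∧ c.refinedRate F G σ =
      ∫ ω, c.logDet F G σ ω.1 (c.sHat F G σ ω.1 (c.latentOutput F G ω)) ∂(c.latentLaw σ) := by
  have hQ := h.posSemidef
  have hm : Measurable fun ω : ℂ × (Fin (N - 1) → ℂ) × ℂ × (Fin N → ℂ) =>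
      (ω.1, CFC.sqrt c.Qd *ᵥ ω.2.1, ω.2.2) := Continuous.measurable (by fun_prop)
  have hc : Continuous (c.refinedLogDet F G σ) := by
    have hx := c.continuous_xp
    have ho : Continuous fun ω : ℂ × (Fin (N - 1) → ℂ) × ℂ × (Fin N → ℂ) =>
        output F G ω.2.2.1 (c.input ω.1 ω.2.1) ω.2.2.2 := by
      unfold output input; fun_prop
    have ht := (c.continuous_sHat F G σ).comp (continuous_fst.prodMk ho)
    have hl := (c.continuous_logDet F G σ hQ).comp (continuous_fst.prodMk ht)
    unfold refinedLogDet
    exact hl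
  have e : ∀ ω : ℂ × (Fin (N - 1) → ℂ) × ℂ × (Fin N → ℂ),
      c.refinedLogDet F G σ (ω.1, CFC.sqrt c.Qd *ᵥ ω.2.1, ω.2.2) =
        c.logDet F G σ ω.1 (c.sHat F G σ ω.1 (c.latentOutput F G ω)) := fun ω => by
    rw [refinedLogDet, latentOutput]
  rw [refinedRate, ← map_latentLaw h, integrable_map_measure hc.aestronglyMeasurable
    hm.aemeasurable, integral_map hm.aemeasurable hc.aestronglyMeasurable]
  simp only [Function.comp_def, e]
  exact ⟨integrable_latent_logDet h, trivial⟩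

theorem integrable_and_integral_latent_sqNorm (h : c.Feasible F G P) :
    Integrable (fun ω => sqNorm ω.2.1) (c.latentLaw σ) ∧
      ∫ ω, sqNorm ω.2.1 ∂(c.latentLaw σ) = (N - 1 : ℕ) := by
  have := h.isProbabilityMeasure
  have hm : Measurable fun ω : ℂ × (Fin (N - 1) → ℂ) × ℂ × (Fin N → ℂ) => sqNorm ω.2.1 :=
    (continuous_sqNorm.comp continuous_snd.fst).measurable
  have hl : ∫⁻ ω, ENNReal.ofReal (sqNorm ω.2.1) ∂(c.latentLaw σ) = (N - 1 : ℕ) := by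
    rw [latentLaw, lintegral_prod _ hm.ennreal_ofReal.aemeasurable]
    have h1 : ∫⁻ u, ENNReal.ofReal (sqNorm u) ∂(stdCN (N - 1)) = (N - 1 : ℕ) := by
      have := lintegral_sqNorm_stdCN 0 (1 : Matrix (Fin (N - 1)) (Fin (N - 1)) ℂ)
      simp only [Matrix.one_mulVec, zero_add] at this
      rw [this, frobSq_eq_trace]
      simp [sqNorm]
    calc _ = ∫⁻ _ : ℂ, ((N - 1 : ℕ) : ℝ≥0∞) ∂c.coarseLaw := by
          refine lintegral_congr fun w => ?_
          rw [← h1]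
          refine (lintegral_prod _
            (hm.ennreal_ofReal.comp measurable_prodMk_left).aemeasurable).trans ?_
          simp
      _ = _ := by simp
  refine ⟨⟨hm.aestronglyMeasurable, ?_⟩, ?_⟩
  · rw [hasFiniteIntegral_iff_ofReal (ae_of_all _ fun ω => sqNorm_nonneg _), hl]
    exact ENNReal.natCast_lt_top _
  · rw [integral_eq_lintegral_of_nonneg_ae (ae_of_all _ fun ω => sqNorm_nonneg _)
      hm.aestronglyMeasurable, hl, ENNReal.toReal_natCast]

theorem integrable_and_integral_latent_errForm (h : c.Feasible F G P) :
    Integrable (fun ω => c.errForm F G σ ω.1 (c.sHat F G σ ω.1 (c.latentOutput F G ω)) ω.2.1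
        (c.residual F G σ ω.1 (c.latentOutput F G ω))) (c.latentLaw σ) ∧
      ∫ ω, c.errForm F G σ ω.1 (c.sHat F G σ ω.1 (c.latentOutput F G ω)) ω.2.1
        (c.residual F G σ ω.1 (c.latentOutput F G ω)) ∂(c.latentLaw σ) = (N - 1 : ℕ) := by
  have := h.isProbabilityMeasure
  have hQ := h.posSemidef
  have hwy : Continuous fun ω => (ω.1, c.latentOutput F G ω) :=
    continuous_fst.prodMk (c.continuous_latentOutput F G)
  have ht := (c.continuous_sHat F G σ).comp hwy
  have hr := (c.continuous_residual F G σ).comp hwy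
  have hm : Measurable fun ω => c.errForm F G σ ω.1 (c.sHat F G σ ω.1 (c.latentOutput F G ω))
      ω.2.1 (c.residual F G σ ω.1 (c.latentOutput F G ω)) :=
    ((c.continuous_errForm F G σ hQ).comp ((continuous_fst.prodMk ht).prodMk
      (continuous_snd.fst.prodMk hr))).measurable
  have hinner : ∀ w, ∫⁻ u, ∫⁻ p : ℂ × (Fin N → ℂ), ENNReal.ofReal (c.errForm F G σ w
      (c.sHat F G σ w (c.latentOutput F G (w, u, p))) u
      (c.residual F G σ w (c.latentOutput F G (w, u, p)))) ∂((scalarCN (σ ^ 2)).prod (stdCN N))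
        ∂(stdCN (N - 1)) = (N - 1 : ℕ) := by
    intro w
    -- the integrand as an opaque function of `u`, `ŝ = t`, `s - ŝ = e` and `Uᴴ z = ζ`
    obtain ⟨f, hf⟩ : ∃ f : (Fin (N - 1) → ℂ) → ℂ → ℂ → (Fin c.dimS → ℂ) → ℝ≥0∞,
        f = fun u t e ζ => ENNReal.ofReal (c.errForm F G σ w t u (c.effChannel F G t *ᵥ u +
          e • (c.Uᴴ *ᵥ (G *ᵥ c.xp w) + (c.Uᴴ * G * c.V * CFC.sqrt c.Qd) *ᵥ u) + ζ)) := ⟨_, rfl⟩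
    have hfm : Measurable fun q : (Fin (N - 1) → ℂ) × ℂ × ℂ × (Fin c.dimS → ℂ) =>
        f q.1 q.2.1 q.2.2.1 q.2.2.2 := by
      have h1 := c.continuous_effChannel F G
      have h2 : Continuous fun q : (Fin (N - 1) → ℂ) × ℂ × ℂ × (Fin c.dimS → ℂ) =>
          c.effChannel F G q.2.1 *ᵥ q.1 + q.2.2.1 • (c.Uᴴ *ᵥ (G *ᵥ c.xp w) +
            (c.Uᴴ * G * c.V * CFC.sqrt c.Qd) *ᵥ q.1) + q.2.2.2 := by
        have h3 : Continuous fun q : (Fin (N - 1) → ℂ) × ℂ × ℂ × (Fin c.dimS → ℂ) =>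
            c.effChannel F G q.2.1 *ᵥ q.1 :=
          (h1.comp continuous_snd.fst).matrix_mulVec continuous_fst
        exact (h3.add (by fun_prop)).add (by fun_prop)
      have h4 := (c.continuous_errForm F G σ hQ).comp
        (((continuous_const (y := w)).prodMk continuous_snd.fst).prodMk (continuous_fst.prodMk h2))
      rw [hf]
      exact h4.measurable.ennreal_ofReal
    calc _ = ∫⁻ u, ∫⁻ t, ∫⁻ e, ∫⁻ ζ, f u t e ζ ∂(stdCN c.dimS)
          ∂(scalarCN (σ ^ 2 * c.errFrac G σ w)) ∂(scalarCN (σ ^ 2 * c.estFrac G σ w))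
          ∂(stdCN (N - 1)) := by
          refine lintegral_congr fun u => ?_
          rw [← lintegral_estimate h w (hfm.comp measurable_prodMk_left)]
          refine lintegral_congr fun p => ?_
          simp only [latentOutput, sHat_output h, residual_output h, hf]
      _ = ∫⁻ t, ∫⁻ u, ∫⁻ e, ∫⁻ ζ, f u t e ζ ∂(stdCN c.dimS)
          ∂(scalarCN (σ ^ 2 * c.errFrac G σ w)) ∂(stdCN (N - 1))
          ∂(scalarCN (σ ^ 2 * c.estFrac G σ w)) := by
          exact lintegral_swap_four _ _ _ _ hfm
      _ = ∫⁻ _ : ℂ, ((N - 1 : ℕ) : ℝ≥0∞) ∂(scalarCN (σ ^ 2 * c.estFrac G σ w)) := by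
          refine lintegral_congr fun t => ?_
          have := lintegral_lmmse_error (σ ^ 2 * c.errFrac G σ w) (c.Uᴴ *ᵥ (G *ᵥ c.xp w))
            (c.Uᴴ * G * c.V * CFC.sqrt c.Qd) (c.effChannel F G t)
          rw [← noiseCov_eq hQ] at this
          rw [hf]
          exact this
      _ = _ := by simp
  have hl : ∫⁻ ω, ENNReal.ofReal (c.errForm F G σ ω.1 (c.sHat F G σ ω.1 (c.latentOutput F G ω))
      ω.2.1 (c.residual F G σ ω.1 (c.latentOutput F G ω))) ∂(c.latentLaw σ) = (N - 1 : ℕ) := by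
    rw [latentLaw, lintegral_prod _ hm.ennreal_ofReal.aemeasurable]
    calc _ = ∫⁻ _ : ℂ, ((N - 1 : ℕ) : ℝ≥0∞) ∂c.coarseLaw := by
          refine lintegral_congr fun w => ?_
          rw [← hinner w]
          exact lintegral_prod _ (hm.ennreal_ofReal.comp measurable_prodMk_left).aemeasurable
      _ = _ := by simp
  refine ⟨⟨hm.aestronglyMeasurable, ?_⟩, ?_⟩
  · rw [hasFiniteIntegral_iff_ofReal (ae_of_all _ fun ω => errForm_nonneg hQ _ _ _ _), hl]
    exact ENNReal.natCast_lt_top _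
  · rw [integral_eq_lintegral_of_nonneg_ae (ae_of_all _ fun ω => errForm_nonneg hQ _ _ _ _)
      hm.aestronglyMeasurable, hl, ENNReal.toReal_natCast]

/-- The mean score is the refined rate: the terms `‖u‖²` and `errForm` both have mean `N - 1`. -/
theorem integrable_and_integral_score (h : c.Feasible F G P) :
    Integrable (fun ω => c.score F G σ ω.1 ω.2.1 (c.latentOutput F G ω)) (c.latentLaw σ) ∧
      ∫ ω, c.score F G σ ω.1 ω.2.1 (c.latentOutput F G ω) ∂(c.latentLaw σ) =
        c.refinedRate F G σ := by
  have h1 := integrable_latent_logDet (σ := σ) h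
  obtain ⟨h2, h2'⟩ := integrable_and_integral_latent_sqNorm (σ := σ) h
  obtain ⟨h3, h3'⟩ := integrable_and_integral_latent_errForm (σ := σ) h
  refine ⟨h1.add (h2.sub h3), ?_⟩
  refine (integral_add h1 (h2.sub h3)).trans ?_
  rw [integral_sub' h2 h3, h2', h3', sub_self, add_zero,
    (integrable_refinedLogDet_and_refinedRate_eq h).2]

/-- The refined decoding metric is normalized. -/
theorem lintegral_exp_score (hQ : c.Qd.PosSemidef) (w : ℂ) (y : Fin N → ℂ) :
    ∫⁻ u, ENNReal.ofReal (Real.exp (c.score F G σ w u y)) ∂(stdCN (N - 1)) = 1 := by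
  set t := c.sHat F G σ w y
  set r := c.residual F G σ w y
  have hM := posDef_one_add_snrMatrix (posDef_noiseCov (G := G) (σ := σ) hQ w)
    (c.effChannel F G t)
  have hpos : 0 < (1 + snrMatrix (c.noiseCov G σ w) (c.effChannel F G t)).det.re :=
    (Complex.pos_iff.1 hM.det_pos).1
  have e : ∀ u, ENNReal.ofReal (Real.exp (c.score F G σ w u y)) =
      ENNReal.ofReal (1 + snrMatrix (c.noiseCov G σ w) (c.effChannel F G t)).det.re *
        ENNReal.ofReal (Real.exp (sqNorm u - c.errForm F G σ w t u r)) := by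
    intro u
    rw [← ENNReal.ofReal_mul hpos.le, ← exp_logDet hQ, ← Real.exp_add]
    rfl
  simp only [e, errForm]
  have hm : Measurable fun u => ENNReal.ofReal (Real.exp (sqNorm u -
      (star (u - lmmse (c.noiseCov G σ w) (c.effChannel F G t) *ᵥ r) ⬝ᵥ
        ((1 + snrMatrix (c.noiseCov G σ w) (c.effChannel F G t)) *ᵥ
          (u - lmmse (c.noiseCov G σ w) (c.effChannel F G t) *ᵥ r))).re)) := by
    apply Measurable.ennreal_ofReal
    apply Continuous.measurable
    have := continuous_sqNorm (n := N - 1)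
    unfold dotProduct
    fun_prop
  rw [lintegral_const_mul _ hm, lintegral_exp_stdCN hM, ← ENNReal.ofReal_mul hpos.le,
    mul_inv_cancel₀ hpos.ne', ENNReal.ofReal_one]

/-! ### Achievability -/

variable (c) in
/-- The law of the transmitted signal `x = x_p + V w_d`. -/
def inputLaw : Measure (Fin N → ℂ) :=
  (c.coarseLaw.prod (stdCN (N - 1))).map
    (Function.uncurry fun w u => c.input w (CFC.sqrt c.Qd *ᵥ u))

variable (c) in
theorem continuous_encoder :
    Continuous (Function.uncurry fun w u => c.input w (CFC.sqrt c.Qd *ᵥ u)) := by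
  have := c.continuous_xp
  unfold input Function.uncurry; fun_prop

/-- The input meets the power constraint: `E ‖x‖² = E |w_p|² + tr Q_d`, as `w_d` is centred and
independent of `w_p` and `V` is semi-unitary. -/
theorem lintegral_sqNorm_inputLaw (h : c.Feasible F G P) :
    ∫⁻ x, ENNReal.ofReal (sqNorm x) ∂c.inputLaw ≤ ENNReal.ofReal P := by
  have := h.isProbabilityMeasure
  have htr : 0 ≤ c.Qd.trace.re := (Complex.le_def.1 h.posSemidef.trace_nonneg).1
  have hm : Measurable fun x : Fin N → ℂ => ENNReal.ofReal (sqNorm x) :=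
    continuous_sqNorm.measurable.ennreal_ofReal
  have hf : frobSq (c.V * CFC.sqrt c.Qd) = c.Qd.trace.re := by
    rw [frobSq_eq_trace', Matrix.conjTranspose_mul, conjTranspose_sqrt, Matrix.mul_assoc,
      ← Matrix.mul_assoc c.Vᴴ, h.aligned.1, Matrix.one_mul, sqrt_mul_sqrt h.posSemidef]
  rw [inputLaw, lintegral_map hm c.continuous_encoder.measurable]
  refine (lintegral_prod _ (hm.comp c.continuous_encoder.measurable).aemeasurable).trans_le ?_
  have h1 : ∀ w, ∫⁻ u, ENNReal.ofReal (sqNorm (Function.uncurry (fun w u =>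
      c.input w (CFC.sqrt c.Qd *ᵥ u)) (w, u))) ∂(stdCN (N - 1)) =
      ENNReal.ofReal (‖w‖ ^ 2) + ENNReal.ofReal c.Qd.trace.re := by
    intro w
    have := lintegral_sqNorm_stdCN (c.xp w) (c.V * CFC.sqrt c.Qd)
    simp only [← Matrix.mulVec_mulVec] at this
    rw [hf, xp, sqNorm_smul, h.unit, mul_one, ENNReal.ofReal_add (sq_nonneg _) htr] at this
    exact this
  refine (lintegral_congr h1).trans_le ?_
  rw [lintegral_add_right _ measurable_const, lintegral_const, measure_univ, mul_one]
  refine (add_le_add_left h.coarsePower _).trans ?_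
  rw [← ENNReal.ofReal_add (sub_nonneg.2 h.refinedPower) htr]
  simp

theorem rate_le_channelInfo (h : c.Feasible F G P) :
    c.rate F G σ ≤ channelInfo F G σ c.inputLaw := by
  have := h.isProbabilityMeasure
  have hQ := h.posSemidef
  obtain ⟨hint, hval⟩ := integrable_and_integral_score (σ := σ) h
  have hchan : Measurable (Function.uncurry fun (x : Fin N → ℂ) (n : ℂ × (Fin N → ℂ)) =>
      output F G n.1 x n.2) :=
    Continuous.measurable (by unfold output Function.uncurry; fun_prop)
  have hproj : Measurable fun y : Fin N → ℂ => c.Uperpᴴ *ᵥ y :=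
    Continuous.measurable (by fun_prop)
  have key := mutualInfo_superposition_le c.coarseLaw (stdCN (N - 1))
    ((scalarCN (σ ^ 2)).prod (stdCN N))
    (enc := fun w u => c.input w (CFC.sqrt c.Qd *ᵥ u))
    (chan := fun x n => output F G n.1 x n.2)
    (proj := fun y => c.Uperpᴴ *ᵥ y)
    (coarse := fun w n => w • (c.Uperpᴴ *ᵥ (F *ᵥ c.vp) + n.1 • (c.Uperpᴴ *ᵥ (G *ᵥ c.vp)))
      + c.Uperpᴴ *ᵥ n.2)
    (φ := c.score F G σ)
    c.continuous_encoder.measurable hchan hproj (c.continuous_score F G σ hQ).measurable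
    (fun w u n => by
      rw [uperp_output h]
      simp only [gPerp, xp, Matrix.mulVec_smul, smul_add]
      rw [smul_comm n.1 w])
    (fun w y => (lintegral_exp_score hQ w y).le) hint
  have hval' : ∫ ω, c.score F G σ ω.1 ω.2.1 (output F G ω.2.2.1
      (c.input ω.1 (CFC.sqrt c.Qd *ᵥ ω.2.1)) ω.2.2.2) ∂(c.coarseLaw.prod ((stdCN (N - 1)).prod
        ((scalarCN (σ ^ 2)).prod (stdCN N)))) = c.refinedRate F G σ := hval
  rw [hval'] at key
  exact key

theorem rate_le_capacity (h : c.Feasible F G P) : c.rate F G σ ≤ capacity F G σ P := by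
  have := h.isProbabilityMeasure
  have hp : IsProbabilityMeasure c.inputLaw :=
    Measure.isProbabilityMeasure_map c.continuous_encoder.measurable.aemeasurable
  refine (rate_le_channelInfo h).trans ?_
  unfold capacity
  exact le_iSup_of_le c.inputLaw (le_iSup_of_le hp
    (le_iSup_of_le (lintegral_sqNorm_inputLaw h) le_rfl))

end Scheme

end DopplerChannel

end

theorem mainTheorem3 (N : ℕ) (hN : 1 ≤ N) (F G : Matrix (Fin N) (Fin N) ℂ) (σ : ℝ≥0)
    (P : ℝ) (hP : 0 ≤ P) :
    (∃ c : DopplerChannel.Scheme N, c.Feasible F G P) ∧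
    (∀ c : DopplerChannel.Scheme N, c.Feasible F G P →
      Integrable (c.refinedLogDet F G σ) (c.law σ) ∧ 0 ≤ c.refinedRate F G σ) ∧
    DopplerChannel.capacity F G σ P
      ≥ ⨆ (c : DopplerChannel.Scheme N) (_ : c.Feasible F G P), c.rate F G σ := by
  refine ⟨DopplerChannel.exists_feasible hN F G hP, fun c hc => ⟨?_, ?_⟩, ?_⟩
  · exact (DopplerChannel.Scheme.integrable_refinedLogDet_and_refinedRate_eq hc).1
  · exact integral_nonneg fun ω => DopplerChannel.Scheme.logDet_nonneg hc.posSemidef _ _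
  · exact iSup₂_le fun c hc => DopplerChannel.Scheme.rate_le_capacity hc
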